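/- Let $n\ge 0$, $0\le k\le n$ and $\rho\in[0,1]$. Let $\mu$ be the uniform distribution on $\{\pm1\}^n$, let $f:\{\pm1\}^n\to\{0,1\}$ be any Boolean function with support $A=f^{-1}(1)$, and let $T_\rho f(x)=\mathbb E[f(Y)\mid X=x]$, where $X\sim\mu$ and $Y$ is obtained from $X$ by independently changing the sign of each coordinate with probability $\frac{1-\rho}{2}$. For $S\subseteq[n]$ with $|S|=k$ and $a\in\{\pm1\}^S$ put $p_{S\mapsto a}(f)=\mu(A\cap\{x: x_S=a\})$ and $\vec p_S(f)=(p_{S\mapsto a}(f))_{a}$, so that $2^k p_{S\mapsto a}(f)$ is the mean of the restriction of $f$ to the subcube $\{x_S=a\}$. For $\alpha\in(0,1)$ and $\beta\in(0,1)$ let $s,\hat s,t,\hat t> 0$ be given by $\alpha=e^{-s^2/2}=1-e^{-\hat s^2/2}$ and $\beta=e^{-t^2/2}=1-e^{-\hat t^2/2}$, and define $\theta_\alpha(\beta)$ (up to finitely many $\beta$) by $$\theta_\alpha(\beta)=\begin{cases} \frac{t-\rho s}{(1-\rho^2)t}\,e^{\frac{t^2}{2}-\frac{s^2+t^2-2\rho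 st}{2(1-\rho^2)}}, & \rho s\le t\le s/\rho \text{ and } \big[(\rho\hat s\le\hat t\le\hat s/\rho,\ t\ge\hat s)\text{ or }\hat t\le\rho\hat s\text{ or }\hat t\ge\hat s/\rho\big],\\ 1-\frac{\hat t-\rho\hat s}{(1-\rho^2)\hat t}\,e^{\frac{\hat t^2}{2}-\frac{\hat s^2+\hat t^2-2\rho\hat s\hat t}{2(1-\rho^2)}}, & \rho\hat s\le\hat t\le\hat s/\rho \text{ and } \big[(\rho s\le t\le s/\rho,\ t\le\hat s)\text{ or }t\le\rho s\text{ or }t\ge s/\rho\big],\\ 0, & t\le\rho s \text{ and } \hat t\ge\hat s/\rho,\\ 1, & t\ge s/\rho \text{ and } \hat t\le\rho\hat s, \end{cases}$$ where $s/\rho=\hat s/\rho=+\infty$ if $\rho=0$; put $\theta_0\equiv0$ and $\theta_1\equiv1$. For $\vec\epsilon=(\epsilon_a)_{a\in\{\pm1\}^k}\in[0,1]^{2^k}$ define $$\Gamma(\vec\epsilon)=2^{-k}\sum_{a\in\{\pm1\}^k}\int_0^1\Phi\Big(\sum_{b\in\{\pm1\}^k}\big(\tfrac{1+\rho}{2}\big)^{k-\frac{|b-a|}{2}}\big(\tfrac{1-\rho}{2}\big)^{\frac{|b-a|}{2}}\theta_{\epsilon_b}(\beta)\Big)\,d\beta,$$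 where $\frac{|b-a|}{2}$ is the number of coordinates in which $a$ and $b$ differ. Theorem. For every continuous convex function $\Phi:[0,1]\to\mathbb R$ and every Boolean function $f$ as above, $$\mathbb E_\mu[\Phi(T_\rho f)]\le\min_{S\subseteq[n]:\,|S|=k}\Gamma\big(2^k\,\vec p_S(f)\big).$$ -/

import Mathlib

namespace NoiseStability

noncomputable section

/-- The discrete cube `{±1}^ι`. -/
abbrev Cube (ι : Type) : Type := ι → ℤˣ

/-- Expectation under the uniform distribution on `{±1}^n`. -/
def mean {n : ℕ} (g : Cube (Fin n) → ℝ) : ℝ :=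
  (∑ x, g x) / 2 ^ n

/-- `f` takes only the values `0` and `1`. -/
def IsBoolean {n : ℕ} (f : Cube (Fin n) → ℝ) : Prop :=
  ∀ x, f x = 0 ∨ f x = 1

/-- The conditional probability that `Y = y` given `X = x`, where `Y` is obtained from `x` by
independently flipping the sign of each coordinate with probability `(1 - ρ) / 2`. -/
def noiseKernel (ρ : ℝ) {n : ℕ} (x y : Cube (Fin n)) : ℝ :=
  ∏ i, if y i = x i then (1 + ρ) / 2 else (1 - ρ) / 2

/-- The Bonami-Beckner operator `T_ρ f (x) = E[f(Y) | X = x]`. -/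
def noiseOp (ρ : ℝ) {n : ℕ} (f : Cube (Fin n) → ℝ) (x : Cube (Fin n)) : ℝ :=
  ∑ y, noiseKernel ρ x y * f y

open Classical in
/-- `p_{S ↦ a}(f) = μ(f · 1{x_S = a})`. -/
def subcubeMass {n : ℕ} (f : Cube (Fin n) → ℝ) (S : Finset (Fin n)) (a : Cube S) : ℝ :=
  mean fun x => if ∀ i : S, x i = a i then f x else 0

/-- The number `s ≥ 0` with `α = exp (-s² / 2)`, for `α ∈ (0, 1]`. -/
def level (α : ℝ) : ℝ := Real.sqrt (-2 * Real.log α)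

/-- `∂/∂β` of `exp (-(s² + t² - 2ρst) / (2(1 - ρ²)))`, where `β = exp (-t² / 2)`. -/
def branch (ρ s t : ℝ) : ℝ :=
  (t - ρ * s) / ((1 - ρ ^ 2) * t) *
    Real.exp (t ^ 2 / 2 - (s ^ 2 + t ^ 2 - 2 * ρ * s * t) / (2 * (1 - ρ ^ 2)))

/-- The interior branches of `θ`, in terms of `s, ŝ, t, t̂` with `α = exp (-s² / 2)`,
`1 - α = exp (-ŝ² / 2)`, `β = exp (-t² / 2)`, `1 - β = exp (-t̂² / 2)`. The condition
`t ≤ s / ρ` is written `ρ * t ≤ s`, which is also right for `ρ = 0`. -/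
def thetaAux (ρ s s' t t' : ℝ) : ℝ :=
  open Classical in
  if (ρ * s ≤ t ∧ ρ * t ≤ s) ∧
      ((ρ * s' ≤ t' ∧ ρ * t' ≤ s' ∧ s' ≤ t) ∨ t' ≤ ρ * s' ∨ s' ≤ ρ * t') then
    branch ρ s t
  else if (ρ * s' ≤ t' ∧ ρ * t' ≤ s') ∧
      ((ρ * s ≤ t ∧ ρ * t ≤ s ∧ t ≤ s') ∨ t ≤ ρ * s ∨ s ≤ ρ * t) then
    1 - branch ρ s' t'
  else if t ≤ ρ * s ∧ s' ≤ ρ * t' then 0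
  else 1

/-- `θ_α(β)`, the derivative in `β` of the small-set-expansion bound `Θ(α, β)` on the noise
stability of sets of measures `α` and `β`, for `α ∈ [0, 1]` and `β ∈ (0, 1)`. For `α = 0` one has
`s = ∞`, and for `α = 1` one has `ŝ = ∞`; then `Θ(0, β) = 0` and `Θ(1, β) = β`. -/
def theta (ρ α β : ℝ) : ℝ :=
  open Classical in
  if α ≤ 0 then 0
  else if 1 ≤ α then 1
  else thetaAux ρ (level α) (level (1 - α)) (level β) (level (1 - β))

/-- The function `Γ` of a vector `ε = (ε_b)` indexed by `b ∈ {±1}^ι`; here `k = |ι|`, and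
`hammingDist b a` is the number `|b - a| / 2` of coordinates in which `a` and `b` differ. -/
def Gamma (Φ : ℝ → ℝ) (ρ : ℝ) {ι : Type} [Fintype ι] [DecidableEq ι] (ε : Cube ι → ℝ) : ℝ :=
  (∑ a : Cube ι, ∫ β in (0 : ℝ)..1,
    Φ (∑ b : Cube ι, ((1 + ρ) / 2) ^ (Fintype.card ι - hammingDist b a) *
      ((1 - ρ) / 2) ^ hammingDist b a * theta ρ (ε b) β)) / 2 ^ Fintype.card ι

end

end NoiseStability

namespace NoiseStability

noncomputable section

/-! Fix `S` and write x = (a, x') with a the coordinates in `S`. The noise kernel is a product, so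
T_ρ f (a, x') = ∑_b K(a, b) T_ρ f_b (x'), where f_b is the restriction of f to {x_S = b} and K(a, b)
is the Hamming weight appearing in Γ. For each a, this function of x' is majorized by β ↦ ∑_b K(a,
b) θ_{ε_b}(β), with ε_b the mean of f_b: its normalized sum over any set of measure β is at most the
integral over [0, β], with equality at β = 1. Both conditions are linear, so they reduce to a single
Boolean function (`sum_cubeNoise_le_integral_theta`, `integral_theta`). A Hardy-Littlewood-Pólya
argument (`sum_le_integral_of_convexOn`) then yields the inequality for convex Φ; only the discrete
side is rearranged, so no monotonicity of θ in β is needed.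

For one Boolean function of mean α and a set of measure β, the bound is generalized small-set
expansion (`sum_cubeNoise_le_expansionBound`): two-function hypercontractivity E[F(X) G(Y)] ≤ ‖F‖_p
‖G‖_q with (p - 1)(q - 1) = ρ², applied to the two indicators with exponents adapted to α and β, and
the trivial bounds α and β where no such exponents exist. When α + β ≥ 1 both sets are replaced by
their complements. θ is the β-derivative of the resulting bound. Hypercontractivity itself
tensorizes (`TwoFunction.cube_fin`) from the two-point space, where it is calculus
(`one_add_mul_le`). -/

/-! ### Hypercontractivity on two points -/

lemma rpow_neg_add_rpow_neg_eq {y d : ℝ} (hy0 : 0 ≤ y) (hy : y < 1) :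
    (1 + y) ^ (-d) + (1 - y) ^ (-d) =
      2 * (Real.exp (d / 2 * -Real.log (1 - y ^ 2)) *
        Real.cosh (d / 2 * (Real.log (1 + y) - Real.log (1 - y)))) := by
  have h1 : 0 < 1 + y := by linarith
  have h2 : 0 < 1 - y := by linarith
  have h3 : Real.log (1 - y ^ 2) = Real.log (1 + y) + Real.log (1 - y) := by
    rw [← Real.log_mul h1.ne' h2.ne']; ring_nf
  rw [Real.rpow_def_of_pos h1, Real.rpow_def_of_pos h2, Real.cosh_eq, h3, mul_div_assoc', mul_add,
    ← Real.exp_add, ← Real.exp_add, mul_div_cancel₀ _ two_ne_zero, add_comm]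
  ring_nf

/-- In the exp-cosh form, -log (1 - y²) and log (1 + y) - log (1 - y) are nonnegative and increasing
in y, so the exponent and the argument of cosh both grow with y and d. This gives the sign of the
second derivative in `twoPoint_sub_one_le`. -/
lemma rpow_neg_add_rpow_neg_le {x y c d : ℝ} (hy0 : 0 ≤ y) (hyx : y ≤ x) (hx : x < 1)
    (hd0 : 0 ≤ d) (hdc : d ≤ c) :
    (1 + y) ^ (-d) + (1 - y) ^ (-d) ≤ (1 + x) ^ (-c) + (1 - x) ^ (-c) := by
  rw [rpow_neg_add_rpow_neg_eq hy0 (hyx.trans_lt hx),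
    rpow_neg_add_rpow_neg_eq (hy0.trans hyx) hx]
  have e1 : 0 ≤ -Real.log (1 - x ^ 2) := by
    have := Real.log_nonpos (x := 1 - x ^ 2) (by nlinarith) (by nlinarith [sq_nonneg x])
    linarith
  have e2 : -Real.log (1 - y ^ 2) ≤ -Real.log (1 - x ^ 2) := by
    have := Real.log_le_log (x := 1 - x ^ 2) (y := 1 - y ^ 2) (by nlinarith) (by nlinarith)
    linarith
  have e3 : 0 ≤ Real.log (1 + y) - Real.log (1 - y) := by
    have := Real.log_le_log (x := 1 - y) (y := 1 + y) (by linarith) (by linarith)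
    linarith
  have e4 : Real.log (1 + y) - Real.log (1 - y) ≤ Real.log (1 + x) - Real.log (1 - x) := by
    have := Real.log_le_log (x := 1 - x) (y := 1 - y) (by linarith) (by linarith)
    have := Real.log_le_log (x := 1 + y) (y := 1 + x) (by linarith) (by linarith)
    linarith
  have e5 : Real.cosh (d / 2 * (Real.log (1 + y) - Real.log (1 - y))) ≤
      Real.cosh (c / 2 * (Real.log (1 + x) - Real.log (1 - x))) := by
    rw [Real.cosh_le_cosh, abs_of_nonneg (by positivity),
      abs_of_nonneg (mul_nonneg (by linarith) (by linarith))]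
    have : 0 ≤ c / 2 := by linarith
    gcongr
  have e6 : d / 2 * -Real.log (1 - y ^ 2) ≤ c / 2 * -Real.log (1 - x ^ 2) :=
    (mul_le_mul_of_nonneg_left e2 (by linarith)).trans
      (mul_le_mul_of_nonneg_right (by linarith) e1)
  have e7 := Real.exp_le_exp.2 e6
  have := Real.cosh_pos (d / 2 * (Real.log (1 + y) - Real.log (1 - y)))
  gcongr

/-- The `L^p` mean of the two-point function `x ↦ 1 + a x` on `{±1}`, before taking the root. -/
def twoPoint (p a : ℝ) : ℝ := ((1 + a) ^ p + (1 - a) ^ p) / 2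

lemma twoPoint_neg (p a : ℝ) : twoPoint p (-a) = twoPoint p a := by
  simp only [twoPoint]; ring_nf

lemma twoPoint_abs (p a : ℝ) : twoPoint p |a| = twoPoint p a := by
  rcases abs_choice a with h | h <;> rw [h]
  exact twoPoint_neg p a

lemma twoPoint_pos {p a : ℝ} (ha : |a| ≤ 1) : 0 < twoPoint p a := by
  obtain ⟨h1, h2⟩ := abs_le.1 ha
  have := Real.rpow_nonneg (show 0 ≤ 1 + a by linarith) p
  have := Real.rpow_nonneg (show 0 ≤ 1 - a by linarith) p
  unfold twoPoint
  rcases le_total 0 a with h | h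
  · have := Real.rpow_pos_of_pos (show 0 < 1 + a by linarith) p
    linarith
  · have := Real.rpow_pos_of_pos (show 0 < 1 - a by linarith) p
    linarith

lemma twoPoint_two (a : ℝ) : twoPoint 2 a = 1 + a ^ 2 := by
  simp only [twoPoint, Real.rpow_two]; ring

lemma hasDerivAt_one_add_mul_rpow {c x : ℝ} (p : ℝ) (h : 0 < 1 + c * x) :
    HasDerivAt (fun x => (1 + c * x) ^ p) (c * p * (1 + c * x) ^ (p - 1)) x := by
  have h1 : HasDerivAt (fun x => 1 + c * x) c x := by
    simpa using ((hasDerivAt_id x).const_mul c).const_add 1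
  exact h1.rpow_const (Or.inl h.ne')

/-- The difference h of the two sides vanishes at 0 together with h', and h'' ≥ 0 on [0, 1). -/
lemma twoPoint_sub_one_le {p r ρ a : ℝ} (hp : 1 < p) (hpr : p ≤ r) (hr : r ≤ 2)
    (hρ0 : 0 ≤ ρ) (hρ1 : ρ ≤ 1) (hρ : ρ ^ 2 * (r - 1) = p - 1) (ha0 : 0 ≤ a) (ha1 : a ≤ 1) :
    1 + p / r * (twoPoint r (ρ * a) - 1) ≤ twoPoint p a := by
  have hr0 : 0 < r := by linarith
  set h' : ℝ → ℝ := fun x => p / 2 * ((1 + 1 * x) ^ (p - 1) - (1 + (-1) * x) ^ (p - 1)) -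
    p * ρ / 2 * ((1 + ρ * x) ^ (r - 1) - (1 + (-ρ) * x) ^ (r - 1)) with h'_def
  set h : ℝ → ℝ := fun x => ((1 + 1 * x) ^ p + (1 + (-1) * x) ^ p) / 2 -
    (1 + p / r * (((1 + ρ * x) ^ r + (1 + (-ρ) * x) ^ r) / 2 - 1)) with h_def
  have pos : ∀ x ∈ Set.Ico (0 : ℝ) 1, 0 < 1 + 1 * x ∧ 0 < 1 + (-1) * x ∧ 0 < 1 + ρ * x ∧
      0 < 1 + (-ρ) * x := by
    rintro x ⟨hx0, hx1⟩
    refine ⟨by linarith, by linarith, by positivity, by nlinarith⟩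
  have cont : ∀ (c e : ℝ), 0 < e → Continuous fun x : ℝ => (1 + c * x) ^ e := fun c e he =>
    Continuous.rpow_const (by fun_prop) fun _ => Or.inr he.le
  have d1 : ∀ x ∈ Set.Ico (0 : ℝ) 1, HasDerivAt h (h' x) x := by
    intro x hx
    obtain ⟨a1, a2, a3, a4⟩ := pos x hx
    have := (((hasDerivAt_one_add_mul_rpow p a1).add (hasDerivAt_one_add_mul_rpow p a2)).div_const
      2).sub ((((((hasDerivAt_one_add_mul_rpow r a3).add
        (hasDerivAt_one_add_mul_rpow r a4)).div_const 2).sub_const 1).const_mul (p / r)).const_add 1)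
    refine this.congr_deriv ?_
    simp only [h'_def]
    field_simp
    ring
  have d2 : ∀ x ∈ Set.Ico (0 : ℝ) 1, HasDerivAt h' (p * (p - 1) / 2 *
      (((1 + x) ^ (-(2 - p)) + (1 - x) ^ (-(2 - p))) -
        ((1 + ρ * x) ^ (-(2 - r)) + (1 - ρ * x) ^ (-(2 - r))))) x := by
    intro x hx
    obtain ⟨a1, a2, a3, a4⟩ := pos x hx
    have := (((hasDerivAt_one_add_mul_rpow (p - 1) a1).sub
      (hasDerivAt_one_add_mul_rpow (p - 1) a2)).const_mul (p / 2)).sub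
      (((hasDerivAt_one_add_mul_rpow (r - 1) a3).sub
        (hasDerivAt_one_add_mul_rpow (r - 1) a4)).const_mul (p * ρ / 2))
    refine this.congr_deriv ?_
    rw [show p - 1 - 1 = -(2 - p) by ring, show r - 1 - 1 = -(2 - r) by ring]
    simp only [one_mul, neg_mul, ← sub_eq_add_neg]
    -- The relation between ρ, r and p makes the two second derivatives carry the same factor p (p -
    -- 1) / 2.
    linear_combination (-(p / 2) * ((1 + ρ * x) ^ (-(2 - r)) + (1 - ρ * x) ^ (-(2 - r)))) * hρ
  have m1 : MonotoneOn h' (Set.Ico 0 1) := by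
    refine monotoneOn_of_deriv_nonneg (convex_Ico 0 1)
      (fun x hx => (d2 x hx).continuousAt.continuousWithinAt)
      (fun x hx => (d2 x (interior_subset hx)).differentiableAt.differentiableWithinAt) ?_
    intro x hx
    have hx' := interior_subset hx
    rw [(d2 x hx').deriv]
    have := rpow_neg_add_rpow_neg_le (x := x) (y := ρ * x) (c := 2 - p) (d := 2 - r)
      (mul_nonneg hρ0 hx'.1) (by nlinarith [hx'.1]) hx'.2 (by linarith) (by linarith)
    have : 0 < p * (p - 1) := mul_pos (by linarith) (by linarith)
    apply mul_nonneg <;> linarith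
  have h'0 : h' 0 = 0 := by simp [h'_def]
  have hc : Continuous h := by
    have := cont 1 p (by linarith)
    have := cont (-1) p (by linarith)
    have := cont ρ r hr0
    have := cont (-ρ) r hr0
    simp only [h_def]
    fun_prop
  have m0 : MonotoneOn h (Set.Icc 0 1) := by
    refine monotoneOn_of_deriv_nonneg (convex_Icc 0 1) hc.continuousOn
      (fun x hx => ?_) ?_
    · rw [interior_Icc] at hx
      exact (d1 x ⟨hx.1.le, hx.2⟩).differentiableAt.differentiableWithinAt
    · intro x hx
      rw [interior_Icc] at hx
      rw [(d1 x ⟨hx.1.le, hx.2⟩).deriv, ← h'0]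
      exact m1 (by simp) ⟨hx.1.le, hx.2⟩ hx.1.le
  have h0 : h 0 = 0 := by simp [h_def]
  have := m0 (by simp) ⟨ha0, ha1⟩ ha0
  rw [h0] at this
  simp only [h_def, one_mul, neg_mul, ← sub_eq_add_neg] at this
  unfold twoPoint
  linarith

/-- Two-point hypercontractivity from `L^p` to `L^r` for `1 < p ≤ r ≤ 2`. -/
lemma twoPoint_rpow_le {p r ρ a : ℝ} (hp : 1 < p) (hpr : p ≤ r) (hr : r ≤ 2)
    (hρ0 : 0 ≤ ρ) (hρ1 : ρ ≤ 1) (hρ : ρ ^ 2 * (r - 1) = p - 1) (ha : |a| ≤ 1) :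
    twoPoint r (ρ * a) ^ (1 / r) ≤ twoPoint p a ^ (1 / p) := by
  have hr0 : 0 < r := by linarith
  have hp0 : 0 < p := by linarith
  rw [← twoPoint_abs p a, ← twoPoint_abs r, abs_mul, abs_of_nonneg hρ0]
  have hpos : 0 < twoPoint r (ρ * |a|) := twoPoint_pos (by
    rw [abs_mul, abs_abs, abs_of_nonneg hρ0]; nlinarith [abs_nonneg a])
  have h1 := twoPoint_sub_one_le hp hpr hr hρ0 hρ1 hρ (abs_nonneg a) ha
  -- Bernoulli's inequality with exponent p / r ≤ 1 linearizes the power.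
  have h2 := _root_.rpow_one_add_le_one_add_mul_self (s := twoPoint r (ρ * |a|) - 1) (by linarith)
    (p := p / r) (by positivity) ((div_le_one hr0).2 hpr)
  rw [add_sub_cancel] at h2
  calc twoPoint r (ρ * |a|) ^ (1 / r) = (twoPoint r (ρ * |a|) ^ (p / r)) ^ (1 / p) := by
        rw [← Real.rpow_mul hpos.le]; congr 1; field_simp
    _ ≤ _ := Real.rpow_le_rpow (by positivity) (h2.trans h1) (by positivity)

/-- 1 + ρab is the mean of (1 + ρax)(1 + bx) over x = ±1. Hölder with q and its conjugate r ≤ 2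
bounds it, and `twoPoint_rpow_le` passes from r back to p. -/
lemma one_add_mul_le_of_two_le {p q ρ a b : ℝ} (hp : 1 < p) (hq : 2 ≤ q)
    (hρ0 : 0 < ρ) (hρ1 : ρ < 1) (hρ : (p - 1) * (q - 1) = ρ ^ 2) (ha : |a| ≤ 1) (hb : |b| ≤ 1) :
    1 + ρ * a * b ≤ twoPoint p a ^ (1 / p) * twoPoint q b ^ (1 / q) := by
  have hq1 : 0 < q - 1 := by linarith
  set r := q / (q - 1) with hr
  have hr1 : r - 1 = 1 / (q - 1) := by rw [hr]; field_simp; ring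
  have hrp : ρ ^ 2 * (r - 1) = p - 1 := by rw [hr1, ← hρ]; field_simp
  have hr2 : r ≤ 2 := by
    have : 1 / (q - 1) ≤ 1 := by rw [div_le_one hq1]; linarith
    linarith
  have hr1' : 0 < r - 1 := by rw [hr1]; positivity
  have hpr : p ≤ r := by
    have : ρ ^ 2 * (r - 1) ≤ 1 * (r - 1) := by gcongr; nlinarith
    linarith
  refine le_trans ?_ (mul_le_mul_of_nonneg_right
    (twoPoint_rpow_le hp hpr hr2 hρ0.le hρ1.le hrp ha) (Real.rpow_nonneg (twoPoint_pos hb).le _))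
  have hc : r.HolderConjugate q := (Real.HolderConjugate.conjExponent (by linarith)).symm
  have ha' : |ρ * a| ≤ 1 := by
    rw [abs_mul, abs_of_pos hρ0]; nlinarith [abs_nonneg a]
  obtain ⟨a1, a2⟩ := abs_le.1 ha'
  obtain ⟨b1, b2⟩ := abs_le.1 hb
  have H := Real.inner_le_Lp_mul_Lq_of_nonneg (Finset.univ : Finset (Fin 2)) hc
    (f := ![1 + ρ * a, 1 - ρ * a]) (g := ![1 + b, 1 - b])
    (by intro i _; fin_cases i <;> simp <;> linarith)
    (by intro i _; fin_cases i <;> simp <;> linarith)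
  simp only [Fin.sum_univ_two, Matrix.cons_val_zero, Matrix.cons_val_one] at H
  have e : ∀ {s x : ℝ}, |x| ≤ 1 → ((1 + x) ^ s + (1 - x) ^ s) ^ (1 / s) =
      (2 : ℝ) ^ (1 / s) * twoPoint s x ^ (1 / s) := by
    intro s x hx
    rw [← Real.mul_rpow zero_le_two (twoPoint_pos hx).le]
    congr 1; unfold twoPoint; ring
  rw [e ha', e hb, mul_mul_mul_comm, ← Real.rpow_add two_pos] at H
  have : 1 / r + 1 / q = 1 := by simpa using hc.inv_add_inv_eq_one
  rw [this, Real.rpow_one] at H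
  linarith

/-- The two-function hypercontractive inequality on the two-point space, normalized. -/
lemma one_add_mul_le {p q ρ a b : ℝ} (hp : 1 < p) (hq : 1 < q)
    (hρ0 : 0 < ρ) (hρ1 : ρ < 1) (hρ : (p - 1) * (q - 1) = ρ ^ 2) (ha : |a| ≤ 1) (hb : |b| ≤ 1) :
    1 + ρ * a * b ≤ twoPoint p a ^ (1 / p) * twoPoint q b ^ (1 / q) := by
  rcases le_or_gt 2 q with hq2 | hq2
  · exact one_add_mul_le_of_two_le hp hq2 hρ0 hρ1 hρ ha hb
  rcases le_or_gt 2 p with hp2 | hp2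
  · have := one_add_mul_le_of_two_le hq hp2 hρ0 hρ1 (by linarith) hb ha
    linarith
  -- With both exponents below 2, each norm is compared with the L² norm, and Cauchy-Schwarz
  -- finishes.
  have key : ∀ {s x : ℝ}, 1 < s → s < 2 → |x| ≤ 1 →
      √(1 + (s - 1) * x ^ 2) ≤ twoPoint s x ^ (1 / s) := by
    intro s x h1 h2 hx
    have hs : √(s - 1) ^ 2 = s - 1 := Real.sq_sqrt (by linarith)
    have := twoPoint_rpow_le (ρ := √(s - 1)) h1 h2.le le_rfl (Real.sqrt_nonneg _)
      (Real.sqrt_le_one.2 (by linarith)) (by rw [hs]; ring) hx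
    rwa [twoPoint_two, mul_pow, hs, ← Real.sqrt_eq_rpow] at this
  refine le_trans ?_ (mul_le_mul (key hp hp2 ha) (key hq hq2 hb) (Real.sqrt_nonneg _)
    (Real.rpow_nonneg (twoPoint_pos ha).le _))
  have h1 : 0 ≤ (p - 1) * a ^ 2 := mul_nonneg (by linarith) (sq_nonneg _)
  have h2 : 0 ≤ (q - 1) * b ^ 2 := mul_nonneg (by linarith) (sq_nonneg _)
  rw [← Real.sqrt_mul (by linarith)]
  apply Real.le_sqrt_of_sq_le
  have e : (ρ * a * b) ^ 2 = ((p - 1) * a ^ 2) * ((q - 1) * b ^ 2) := by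
    linear_combination (-(a ^ 2 * b ^ 2)) * hρ
  have : 2 * (ρ * a * b) ≤ (p - 1) * a ^ 2 + (q - 1) * b ^ 2 := by
    refine (abs_le_of_sq_le_sq' ?_ (by linarith)).2
    nlinarith [sq_nonneg ((p - 1) * a ^ 2 - (q - 1) * b ^ 2)]
  nlinarith

/-! ### Noise on the cube and tensorization -/

/-- The transition probabilities of the noise operator on a single coordinate. -/
def bitKernel (ρ : ℝ) (x y : ℤˣ) : ℝ := if y = x then (1 + ρ) / 2 else (1 - ρ) / 2

/-- The transition probabilities of the noise operator on the cube `{±1}^ι`. -/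
def cubeKernel (ρ : ℝ) {ι : Type} [Fintype ι] (x y : Cube ι) : ℝ := ∏ i, bitKernel ρ (x i) (y i)

/-- The noise operator on the cube `{±1}^ι`. -/
def cubeNoise (ρ : ℝ) {ι : Type} [Fintype ι] [DecidableEq ι] (f : Cube ι → ℝ) (x : Cube ι) : ℝ :=
  ∑ y, cubeKernel ρ x y * f y

lemma sum_sign (g : ℤˣ → ℝ) : ∑ x, g x = g 1 + g (-1) := by
  rw [UnitsInt.univ, Finset.sum_pair (by decide)]

lemma bitKernel_comm (ρ : ℝ) (x y : ℤˣ) : bitKernel ρ x y = bitKernel ρ y x := by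
  simp only [bitKernel, eq_comm]

lemma bitKernel_nonneg {ρ : ℝ} (hρ : ρ ∈ Set.Icc (0 : ℝ) 1) (x y : ℤˣ) : 0 ≤ bitKernel ρ x y := by
  obtain ⟨h0, h1⟩ := hρ
  unfold bitKernel; split_ifs <;> linarith

lemma sum_bitKernel (ρ : ℝ) (x : ℤˣ) : ∑ y, bitKernel ρ x y = 1 := by
  rcases Int.units_eq_one_or x with rfl | rfl <;> rw [sum_sign] <;>
    simp only [bitKernel] <;> norm_num <;> ring

/-- The two-function hypercontractive inequality with noise `ρ` and exponents `p`, `q` on the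
two-point space. -/
def TwoFunction (ρ p q : ℝ) : Prop :=
  ∀ u w : ℤˣ → ℝ, (∀ x, 0 ≤ u x) → (∀ x, 0 ≤ w x) →
    (∑ x, ∑ y, bitKernel ρ x y * (u x * w y)) / 2 ≤
      ((∑ x, u x ^ p) / 2) ^ (1 / p) * ((∑ x, w x ^ q) / 2) ^ (1 / q)

lemma twoFunction_zero : TwoFunction 0 1 1 := by
  intro u w _ _
  simp only [sum_sign, bitKernel]
  norm_num
  apply le_of_eq
  ring

/-- By homogeneity this reduces the two-function inequality to the normalized functions 1 + ax. -/
lemma exists_eq_mul_one_add {u : ℤˣ → ℝ} (hu : ∀ x, 0 ≤ u x) :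
    ∃ m a : ℝ, 0 ≤ m ∧ |a| ≤ 1 ∧ u 1 = m * (1 + a) ∧ u (-1) = m * (1 - a) := by
  have h1 := hu 1
  have h2 := hu (-1)
  rcases eq_or_lt_of_le (add_nonneg h1 h2) with h | h
  · exact ⟨0, 0, le_rfl, by simp, by linarith, by linarith⟩
  · refine ⟨(u 1 + u (-1)) / 2, (u 1 - u (-1)) / (u 1 + u (-1)), by linarith, ?_, ?_, ?_⟩
    · rw [abs_div, abs_of_pos h, div_le_one h, abs_le]
      constructor <;> linarith
    · field_simp; ring
    · field_simp; ring

lemma twoFunction_of_lt_one {ρ p q : ℝ} (hp : 1 < p) (hq : 1 < q) (hρ0 : 0 < ρ) (hρ1 : ρ < 1)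
    (hρ : (p - 1) * (q - 1) = ρ ^ 2) : TwoFunction ρ p q := by
  intro u w hu hw
  obtain ⟨m, a, hm, ha, hu1, hu2⟩ := exists_eq_mul_one_add hu
  obtain ⟨l, b, hl, hb, hw1, hw2⟩ := exists_eq_mul_one_add hw
  have key : ∀ {s k c : ℝ}, 1 < s → 0 ≤ k → |c| ≤ 1 →
      (((k * (1 + c)) ^ s + (k * (1 - c)) ^ s) / 2) ^ (1 / s) = k * twoPoint s c ^ (1 / s) := by
    intro s k c hs hk hc
    obtain ⟨c1, c2⟩ := abs_le.1 hc
    rw [Real.mul_rpow hk (by linarith), Real.mul_rpow hk (by linarith), ← mul_add, mul_div_assoc]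
    change (k ^ s * twoPoint s c) ^ (1 / s) = _
    rw [Real.mul_rpow (by positivity) (twoPoint_pos hc).le, ← Real.rpow_mul hk,
      mul_one_div_cancel (by linarith), Real.rpow_one]
  simp only [sum_sign, hu1, hu2, hw1, hw2, key hp hm ha, key hq hl hb]
  have h := mul_le_mul_of_nonneg_left (one_add_mul_le hp hq hρ0 hρ1 hρ ha hb) (mul_nonneg hm hl)
  calc _ = m * l * (1 + ρ * a * b) := by
        simp only [bitKernel, if_true, if_neg (by decide : ¬ (-1 : ℤˣ) = 1),
          if_neg (by decide : ¬ (1 : ℤˣ) = -1)]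
        ring
    _ ≤ _ := h
    _ = _ := by ring

/-- Split off the first coordinate: for fixed first bits the induction hypothesis bounds the inner
sums by products of partial norms, and the two-point inequality applies to these norms as functions
of the bit. -/
lemma TwoFunction.cube_fin {ρ p q : ℝ} (h : TwoFunction ρ p q) (hρ : ρ ∈ Set.Icc (0 : ℝ) 1)
    (hp : 0 < p) (hq : 0 < q) (n : ℕ) : ∀ F G : Cube (Fin n) → ℝ,
    (∀ x, 0 ≤ F x) → (∀ x, 0 ≤ G x) →
    (∑ x, ∑ y, cubeKernel ρ x y * (F x * G y)) / 2 ^ n ≤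
      ((∑ x, F x ^ p) / 2 ^ n) ^ (1 / p) * ((∑ x, G x ^ q) / 2 ^ n) ^ (1 / q) := by
  induction n with
  | zero =>
    intro F G hF hG
    simp [cubeKernel, ← Real.rpow_mul, hF, hG, hp.ne', hq.ne']
  | succ n ih =>
    intro F G hF hG
    have split : ∀ g : Cube (Fin (n + 1)) → ℝ, ∑ x, g x = ∑ s : ℤˣ, ∑ x : Cube (Fin n),
        g (Fin.cons s x) := by
      intro g
      rw [← Fintype.sum_prod_type', ← (Fin.consEquiv fun _ => ℤˣ).sum_comp]
      rfl
    have hker : ∀ (s t : ℤˣ) (x y : Cube (Fin n)),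
        cubeKernel ρ (Fin.cons s x : Cube (Fin (n + 1))) (Fin.cons t y) =
          bitKernel ρ s t * cubeKernel ρ x y := by
      intro s t x y
      simp [cubeKernel, Fin.prod_univ_succ]
    have key := h (fun s => ((∑ x, F (Fin.cons s x) ^ p) / 2 ^ n) ^ (1 / p))
      (fun s => ((∑ x, G (Fin.cons s x) ^ q) / 2 ^ n) ^ (1 / q))
      (fun s => Real.rpow_nonneg (div_nonneg
        (Finset.sum_nonneg fun x _ => Real.rpow_nonneg (hF _) _) (by positivity)) _)
      (fun s => Real.rpow_nonneg (div_nonneg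
        (Finset.sum_nonneg fun x _ => Real.rpow_nonneg (hG _) _) (by positivity)) _)
    have pw : ∀ {r : ℝ} {H : Cube (Fin (n + 1)) → ℝ}, 0 < r → (∀ x, 0 ≤ H x) → ∀ s : ℤˣ,
        (((∑ x, H (Fin.cons s x) ^ r) / 2 ^ n) ^ (1 / r)) ^ r =
          (∑ x, H (Fin.cons s x) ^ r) / 2 ^ n := by
      intro r H hr hH s
      rw [← Real.rpow_mul (div_nonneg
        (Finset.sum_nonneg fun x _ => Real.rpow_nonneg (hH _) _) (by positivity)),
        one_div_mul_cancel hr.ne', Real.rpow_one]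
    simp only [pw hp hF, pw hq hG, ← Finset.sum_div, div_div] at key
    rw [← pow_succ, ← split (fun x => F x ^ p), ← split (fun x => G x ^ q)] at key
    refine le_trans ?_ key
    rw [split, pow_succ, ← div_div, Finset.sum_div]
    gcongr with s _
    calc (∑ x, ∑ y, cubeKernel ρ (Fin.cons s x : Cube (Fin (n + 1))) y *
          (F (Fin.cons s x) * G y)) / 2 ^ n
        = ∑ t, bitKernel ρ s t * ((∑ x, ∑ y, cubeKernel ρ x y *
          (F (Fin.cons s x) * G (Fin.cons t y))) / 2 ^ n) := by
          simp_rw [split, hker]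
          rw [Finset.sum_comm, Finset.sum_div]
          refine Finset.sum_congr rfl fun t _ => ?_
          rw [← mul_div_assoc, Finset.mul_sum]
          congr 1
          refine Finset.sum_congr rfl fun x _ => ?_
          rw [Finset.mul_sum]
          exact Finset.sum_congr rfl fun y _ => by ring
      _ ≤ _ := by
          gcongr with t _
          · exact bitKernel_nonneg hρ _ _
          · exact ih _ _ (fun _ => hF _) (fun _ => hG _)

/-- The two-function hypercontractive inequality on the cube. -/
lemma TwoFunction.cube {ρ p q : ℝ} (h : TwoFunction ρ p q) (hρ : ρ ∈ Set.Icc (0 : ℝ) 1)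
    (hp : 0 < p) (hq : 0 < q) {ι : Type} [Fintype ι] [DecidableEq ι] {F G : Cube ι → ℝ}
    (hF : ∀ x, 0 ≤ F x) (hG : ∀ x, 0 ≤ G x) :
    (∑ x, ∑ y, cubeKernel ρ x y * (F x * G y)) / 2 ^ Fintype.card ι ≤
      ((∑ x, F x ^ p) / 2 ^ Fintype.card ι) ^ (1 / p) *
        ((∑ x, G x ^ q) / 2 ^ Fintype.card ι) ^ (1 / q) := by
  let e : Cube (Fin (Fintype.card ι)) ≃ Cube ι :=
    (Fintype.equivFin ι).symm.arrowCongr (Equiv.refl ℤˣ)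
  have key := h.cube_fin hρ hp hq (Fintype.card ι) (fun x => F (e x)) (fun x => G (e x))
    (fun _ => hF _) (fun _ => hG _)
  have hker : ∀ x y, cubeKernel ρ x y = cubeKernel ρ (e x) (e y) := by
    intro x y
    simp only [cubeKernel]
    rw [← (Fintype.equivFin ι).prod_comp]
    rfl
  simp only [hker] at key
  rw [e.sum_comp (fun x => F x ^ p), e.sum_comp (fun x => G x ^ q),
    e.sum_comp (fun x => ∑ y, cubeKernel ρ x (e y) * (F x * G (e y)))] at key
  simp only [fun x => e.sum_comp (fun y => cubeKernel ρ x y * (F x * G y))] at key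
  exact key

lemma cubeKernel_nonneg {ρ : ℝ} (hρ : ρ ∈ Set.Icc (0 : ℝ) 1) {ι : Type} [Fintype ι]
    (x y : Cube ι) : 0 ≤ cubeKernel ρ x y :=
  Finset.prod_nonneg fun _ _ => bitKernel_nonneg hρ _ _

lemma cubeKernel_comm (ρ : ℝ) {ι : Type} [Fintype ι] (x y : Cube ι) :
    cubeKernel ρ x y = cubeKernel ρ y x :=
  Finset.prod_congr rfl fun _ _ => bitKernel_comm _ _ _

lemma sum_cubeKernel (ρ : ℝ) {ι : Type} [Fintype ι] [DecidableEq ι] (x : Cube ι) :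
    ∑ y, cubeKernel ρ x y = 1 := by
  have := Finset.prod_univ_sum (fun _ : ι => (Finset.univ : Finset ℤˣ))
    (fun i y => bitKernel ρ (x i) y)
  simp only [Fintype.piFinset_univ, sum_bitKernel, Finset.prod_const_one] at this
  exact this.symm

lemma cubeNoise_mem_Icc {ρ : ℝ} (hρ : ρ ∈ Set.Icc (0 : ℝ) 1) {ι : Type} [Fintype ι]
    [DecidableEq ι] {f : Cube ι → ℝ} (hf : ∀ x, f x ∈ Set.Icc (0 : ℝ) 1) (x : Cube ι) :
    cubeNoise ρ f x ∈ Set.Icc (0 : ℝ) 1 := by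
  refine ⟨Finset.sum_nonneg fun y _ => mul_nonneg (cubeKernel_nonneg hρ _ _) (hf y).1, ?_⟩
  rw [← sum_cubeKernel ρ x]
  exact Finset.sum_le_sum fun y _ => mul_le_of_le_one_right (cubeKernel_nonneg hρ _ _) (hf y).2

lemma sum_cubeNoise (ρ : ℝ) {ι : Type} [Fintype ι] [DecidableEq ι] (f : Cube ι → ℝ) :
    ∑ x, cubeNoise ρ f x = ∑ y, f y := by
  simp only [cubeNoise]
  rw [Finset.sum_comm]
  refine Finset.sum_congr rfl fun y _ => ?_
  simp_rw [cubeKernel_comm ρ _ y]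
  rw [← Finset.sum_mul, sum_cubeKernel, one_mul]

/-! ### Levels and the branches of θ -/

lemma level_nonneg (α : ℝ) : 0 ≤ level α := Real.sqrt_nonneg _

lemma level_sq {α : ℝ} (h0 : 0 < α) (h1 : α ≤ 1) : level α ^ 2 = -2 * Real.log α :=
  Real.sq_sqrt (by have := Real.log_nonpos h0.le h1; linarith)

lemma exp_neg_level_sq {α : ℝ} (h0 : 0 < α) (h1 : α ≤ 1) : Real.exp (-(level α ^ 2 / 2)) = α := by
  rw [level_sq h0 h1, show -(-2 * Real.log α / 2) = Real.log α by ring, Real.exp_log h0]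

lemma level_lt_level {α β : ℝ} (h0 : 0 < α) (hαβ : α < β) (h1 : β ≤ 1) : level β < level α :=
  Real.sqrt_lt_sqrt (by have := Real.log_nonpos (h0.trans hαβ).le h1; linarith)
    (by have := Real.log_lt_log h0 hαβ; linarith)

lemma level_one : level 1 = 0 := by simp [level]

lemma level_pos {α : ℝ} (h0 : 0 < α) (h1 : α < 1) : 0 < level α := by
  simpa [level_one] using level_lt_level h0 h1 le_rfl

/-- log x · log (1 - x) is symmetric about 1/2 and strictly decreasing on [1/2, 1), and the
hypotheses say that p is closer to 1/2 than q. The sign of the derivative compares two secants of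
the concave logarithm through 1. -/
lemma log_mul_log_lt_log_mul_log {p q : ℝ} (hp : 1 - q < p) (hpq : p < q) (hq : q < 1) :
    Real.log q * Real.log (1 - q) < Real.log p * Real.log (1 - p) := by
  have anti : StrictAntiOn (fun x => Real.log x * Real.log (1 - x)) (Set.Ico (1 / 2) 1) := by
    have hd : ∀ x ∈ Set.Ico (1 / 2 : ℝ) 1, HasDerivAt (fun x => Real.log x * Real.log (1 - x))
        (x⁻¹ * Real.log (1 - x) + Real.log x * (-1 / (1 - x))) x := fun x hx =>
      (Real.hasDerivAt_log (by linarith [hx.1])).mul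
        (((hasDerivAt_id x).const_sub 1).log (by simp only [id]; linarith [hx.2]))
    refine strictAntiOn_of_deriv_neg (convex_Ico _ _)
      (fun x hx => (hd x hx).continuousAt.continuousWithinAt) fun x hx => ?_
    rw [interior_Ico] at hx
    obtain ⟨h1, h2⟩ := hx
    rw [(hd x ⟨h1.le, h2⟩).deriv]
    have hx0 : 0 < x := by linarith
    have hy0 : 0 < 1 - x := by linarith
    have := strictConcaveOn_log_Ioi.secant_strict_mono (a := 1) (x := 1 - x) (y := x)
      (by simp) (by simpa using h2) (by simpa using hx0) (by linarith) (by linarith) (by linarith)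
    simp only [Real.log_one, sub_zero] at this
    rw [show x - 1 = -(1 - x) by ring, show 1 - x - 1 = -x by ring, div_neg, div_neg] at this
    rw [inv_mul_eq_div, mul_div_assoc', mul_neg_one, neg_div]
    linarith
  rcases le_or_gt (1 / 2) p with h | h
  · exact anti ⟨h, by linarith⟩ ⟨by linarith, hq⟩ hpq
  · have := anti (a := 1 - p) (b := q) ⟨by linarith, by linarith⟩ ⟨by linarith, hq⟩ (by linarith)
    simp only [sub_sub_cancel] at this
    linarith

/-- With p = β^(ρ²), the hypotheses read p ≤ α and 1 - β ≤ (1 - α)^(ρ²), hence log β · log (1 - β) ≥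
log p · log (1 - p). But β < p < 1 - β, so the preceding lemma gives the opposite strict inequality.
-/
lemma not_level_le_of_add_lt_one {ρ α β : ℝ} (hρ0 : 0 ≤ ρ) (hρ1 : ρ < 1) (hα : 0 < α) (hβ : 0 < β)
    (h : α + β < 1) (h1 : level α ≤ ρ * level β) (h2 : ρ * level (1 - α) ≤ level (1 - β)) :
    False := by
  rcases eq_or_lt_of_le hρ0 with rfl | hρ0
  · have := level_pos hα (by linarith)
    linarith
  have k1 := pow_le_pow_left₀ (level_nonneg _) h1 2
  have k2 := pow_le_pow_left₀ (mul_nonneg hρ0.le (level_nonneg _)) h2 2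
  rw [mul_pow, level_sq (by linarith) (by linarith), level_sq (by linarith) (by linarith)] at k1 k2
  have hr0 : 0 < ρ ^ 2 := by positivity
  have hr1 : ρ ^ 2 < 1 := by nlinarith
  have hlb : Real.log β < 0 := Real.log_neg hβ (by linarith)
  set p := β ^ (ρ ^ 2) with hp
  have hp0 : 0 < p := Real.rpow_pos_of_pos hβ _
  have lp : Real.log p = ρ ^ 2 * Real.log β := Real.log_rpow hβ _
  have hpa : p ≤ α := by
    rw [← Real.log_le_log_iff hp0 hα, lp]; linarith
  have hpb : β < p := by
    rw [← Real.log_lt_log_iff hβ hp0, lp]; nlinarith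
  have key := log_mul_log_lt_log_mul_log (p := p) (q := 1 - β) (by linarith) (by linarith)
    (by linarith)
  have l1 : Real.log (1 - α) ≤ Real.log (1 - p) :=
    Real.log_le_log (by linarith) (by linarith)
  have l2 : Real.log (1 - β) ≤ ρ ^ 2 * Real.log (1 - p) := by
    have := mul_le_mul_of_nonneg_left l1 hr0.le
    linarith
  rw [sub_sub_cancel, lp] at key
  have := mul_le_mul_of_nonpos_right l2 hlb.le
  linarith

/-- The derivative in `β` of the small-set-expansion bound, in terms of levels. -/
def slope (ρ s t : ℝ) : ℝ :=
  open Classical in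
  if ρ * s ≤ t ∧ ρ * t ≤ s then branch ρ s t else if t ≤ ρ * s then 0 else 1

lemma level_facts {ρ α β : ℝ} (hρ0 : 0 ≤ ρ) (hρ1 : ρ < 1) (hα : 0 < α) (hβ : 0 < β)
    (h : α + β < 1) :
    level (1 - α) < level β ∧ level (1 - β) < level α ∧
    (level α ≤ ρ * level β → level (1 - β) < ρ * level (1 - α)) ∧
    (level β ≤ ρ * level α → level (1 - α) < ρ * level (1 - β)) := by
  refine ⟨level_lt_level hβ (by linarith) (by linarith),
    level_lt_level hα (by linarith) (by linarith), fun h1 => ?_, fun h1 => ?_⟩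
  · by_contra! h2
    exact not_level_le_of_add_lt_one hρ0 hρ1 hα hβ h h1 h2
  · by_contra! h2
    exact not_level_le_of_add_lt_one hρ0 hρ1 hβ hα (by linarith) h1 h2

lemma level_lt_iff {α β : ℝ} (hα : α ∈ Set.Ioo (0 : ℝ) 1) (hβ : β ∈ Set.Ioo (0 : ℝ) 1) :
    level α < level β ↔ level (1 - β) < level (1 - α) := by
  have key : ∀ {x y : ℝ}, x ∈ Set.Ioo (0 : ℝ) 1 → y ∈ Set.Ioo (0 : ℝ) 1 →
      (level x < level y ↔ y < x) := by
    intro x y hx hy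
    refine ⟨fun h => ?_, fun h => level_lt_level hy.1 h hx.2.le⟩
    by_contra! h'
    rcases h'.eq_or_lt with rfl | h'
    · exact h.ne rfl
    · exact h.not_gt (level_lt_level hx.1 h' hy.2.le)
  rw [key hα hβ, key ⟨by linarith [hβ.2], by linarith [hβ.1]⟩
    ⟨by linarith [hα.2], by linarith [hα.1]⟩]
  constructor <;> intro <;> linarith

/-- Here ŝ < t, and by `level_facts` a trivial regime for (s, t) forces the opposite trivial regime
for (ŝ, t̂), so the complementary branch is never selected. -/
lemma theta_of_add_lt_one {ρ α β : ℝ} (hρ0 : 0 ≤ ρ) (hρ1 : ρ < 1) (hα : 0 < α) (hβ : 0 < β)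
    (h : α + β < 1) : theta ρ α β = slope ρ (level α) (level β) := by
  obtain ⟨f1, f2, f3, f4⟩ := level_facts hρ0 hρ1 hα hβ h
  have f5 := level_lt_iff (α := α) (β := β) ⟨hα, by linarith⟩ ⟨hβ, by linarith⟩
  have f6 := level_lt_iff (β := α) (α := β) ⟨hβ, by linarith⟩ ⟨hα, by linarith⟩
  have p1 := level_pos hα (by linarith)
  have p2 := level_pos hβ (by linarith)
  have p3 := level_pos (α := 1 - α) (by linarith) (by linarith)
  have p4 := level_pos (α := 1 - β) (by linarith) (by linarith)
  rw [theta, if_neg (by linarith), if_neg (by linarith)]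
  generalize level α = s at *
  generalize level β = t at *
  generalize level (1 - α) = s' at *
  generalize level (1 - β) = t' at *
  have g : ∀ x : ℝ, 0 < x → ρ * x < x := fun x hx => by nlinarith
  have g1 := g s p1
  have g2 := g t p2
  have g3 := g s' p3
  have g4 := g t' p4
  unfold thetaAux slope
  generalize branch ρ s t = b1
  generalize branch ρ s' t' = b2
  generalize ρ * s = rs at *
  generalize ρ * t = rt at *
  generalize ρ * s' = rs' at *
  generalize ρ * t' = rt' at *
  clear g
  grind

lemma theta_of_one_lt_add {ρ α β : ℝ} (hρ0 : 0 ≤ ρ) (hρ1 : ρ < 1) (hα : α < 1) (hβ : β < 1)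
    (h : 1 < α + β) : theta ρ α β = 1 - slope ρ (level (1 - α)) (level (1 - β)) := by
  obtain ⟨f1, f2, f3, f4⟩ := level_facts hρ0 hρ1 (α := 1 - α) (β := 1 - β) (by linarith)
    (by linarith) (by linarith)
  simp only [sub_sub_cancel] at f1 f2 f3 f4
  have f5 := level_lt_iff (α := α) (β := β) ⟨by linarith, by linarith⟩ ⟨by linarith, by linarith⟩
  have f6 := level_lt_iff (β := α) (α := β) ⟨by linarith, by linarith⟩ ⟨by linarith, by linarith⟩
  have p1 := level_pos (α := α) (by linarith) (by linarith)
  have p2 := level_pos (α := β) (by linarith) (by linarith)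
  have p3 := level_pos (α := 1 - α) (by linarith) (by linarith)
  have p4 := level_pos (α := 1 - β) (by linarith) (by linarith)
  rw [theta, if_neg (by linarith), if_neg (by linarith)]
  generalize level α = s at *
  generalize level β = t at *
  generalize level (1 - α) = s' at *
  generalize level (1 - β) = t' at *
  have g : ∀ x : ℝ, 0 < x → ρ * x < x := fun x hx => by nlinarith
  have g1 := g s p1
  have g2 := g t p2
  have g3 := g s' p3
  have g4 := g t' p4
  unfold thetaAux slope
  generalize branch ρ s t = b1
  generalize branch ρ s' t' = b2
  generalize ρ * s = rs at *
  generalize ρ * t = rt at *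
  generalize ρ * s' = rs' at *
  generalize ρ * t' = rt' at *
  clear g
  grind

lemma theta_one_of_lt {α β : ℝ} (hα1 : α < 1) (hβ : 0 < β) (h : β < α) : theta 1 α β = 1 := by
  have f1 := level_lt_level hβ h hα1.le
  have f2 := level_lt_level (α := 1 - α) (β := 1 - β) (by linarith) (by linarith) (by linarith)
  rw [theta, if_neg (by linarith), if_neg (by linarith), thetaAux]
  grind

lemma theta_one_of_gt {α β : ℝ} (hα0 : 0 < α) (hβ : β < 1) (h : α < β) : theta 1 α β = 0 := by
  have f1 := level_lt_level hα0 h hβ.le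
  have f2 := level_lt_level (α := 1 - β) (β := 1 - α) (by linarith) (by linarith) (by linarith)
  rw [theta, if_neg (by linarith), if_neg (by linarith), thetaAux]
  grind

lemma branch_mem_Icc {ρ s t : ℝ} (hρ0 : 0 ≤ ρ) (hρ1 : ρ ≤ 1) (ht : 0 ≤ t) (h1 : ρ * s ≤ t)
    (h2 : ρ * t ≤ s) : branch ρ s t ∈ Set.Icc (0 : ℝ) 1 := by
  -- For t = 0 or ρ = 1 the denominator vanishes, and division by zero makes the branch 0.
  rcases ht.eq_or_lt with rfl | ht
  · simp [branch]
  rcases hρ1.eq_or_lt with rfl | hρ1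
  · simp [branch]
  have hr : 0 < 1 - ρ ^ 2 := by nlinarith
  unfold branch
  have e0 : 0 ≤ (t - ρ * s) / ((1 - ρ ^ 2) * t) := div_nonneg (by linarith) (by positivity)
  refine ⟨mul_nonneg e0 (Real.exp_pos _).le, mul_le_one₀ ?_ (Real.exp_pos _).le ?_⟩
  · rw [div_le_one (by positivity)]; nlinarith
  · rw [Real.exp_le_one_iff, sub_nonpos, le_div_iff₀ (by positivity)]
    nlinarith [sq_nonneg (s - ρ * t)]

lemma theta_mem_Icc {ρ : ℝ} (hρ : ρ ∈ Set.Icc (0 : ℝ) 1) (α β : ℝ) :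
    theta ρ α β ∈ Set.Icc (0 : ℝ) 1 := by
  unfold theta thetaAux
  split_ifs with h1 h2 h3 h4
  · simp
  · simp
  · exact branch_mem_Icc hρ.1 hρ.2 (level_nonneg _) h3.1.1 h3.1.2
  · obtain ⟨k1, k2⟩ := branch_mem_Icc hρ.1 hρ.2 (level_nonneg _) h4.1.1 h4.1.2
    constructor <;> linarith
  · simp
  · simp

lemma measurable_level : Measurable level := by
  unfold level; fun_prop

lemma measurable_branch (ρ s : ℝ) : Measurable (branch ρ s) := by
  unfold branch; fun_prop

lemma measurable_theta (ρ α : ℝ) : Measurable (theta ρ α) := by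
  classical
  have hl := measurable_level
  have hb := measurable_branch ρ
  unfold theta
  by_cases h0 : α ≤ 0
  · simp only [h0, if_true]; fun_prop
  by_cases h1 : 1 ≤ α
  · simp only [h0, h1, if_true, if_false]; fun_prop
  simp only [h0, h1, if_false, thetaAux]
  have m : ∀ {f g : ℝ → ℝ}, Measurable f → Measurable g → MeasurableSet {x | f x ≤ g x} :=
    fun hf hg => measurableSet_le hf hg
  refine Measurable.ite ?_ (by fun_prop) (Measurable.ite ?_ (by fun_prop)
    (Measurable.ite ?_ measurable_const measurable_const))
  · exact ((m (by fun_prop) (by fun_prop)).inter (m (by fun_prop) (by fun_prop))).inter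
      (((m (by fun_prop) (by fun_prop)).inter ((m (by fun_prop) (by fun_prop)).inter
        (m (by fun_prop) (by fun_prop)))).union
        ((m (by fun_prop) (by fun_prop)).union (m (by fun_prop) (by fun_prop))))
  · exact ((m (by fun_prop) (by fun_prop)).inter (m (by fun_prop) (by fun_prop))).inter
      (((m (by fun_prop) (by fun_prop)).inter ((m (by fun_prop) (by fun_prop)).inter
        (m (by fun_prop) (by fun_prop)))).union
        ((m (by fun_prop) (by fun_prop)).union (m (by fun_prop) (by fun_prop))))
  · exact (m (by fun_prop) (by fun_prop)).inter (m (by fun_prop) (by fun_prop))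

/-! ### The expansion bound as an integral of θ -/

open Classical in
/-- `-log` of the small-set-expansion bound, in terms of levels. -/
def boundExponent (ρ s t : ℝ) : ℝ :=
  if s ≤ ρ * t then t ^ 2 / 2
  else if t ≤ ρ * s then s ^ 2 / 2
  else (s ^ 2 + t ^ 2 - 2 * ρ * s * t) / (2 * (1 - ρ ^ 2))

/-- The small-set-expansion bound on the noise stability of sets of measures `α` and `β`. -/
def expansionBound (ρ α β : ℝ) : ℝ :=
  open Classical in
  if β ≤ 0 then 0 else Real.exp (-boundExponent ρ (level α) (level β))

lemma boundExponent_comm {ρ s t : ℝ} (hρ1 : ρ < 1) (hs : 0 < s) (ht : 0 < t) :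
    boundExponent ρ s t = boundExponent ρ t s := by
  have g : ∀ x : ℝ, 0 < x → ρ * x < x := fun x hx => by nlinarith
  have g1 := g s hs
  have g2 := g t ht
  unfold boundExponent
  rw [show t ^ 2 + s ^ 2 - 2 * ρ * t * s = s ^ 2 + t ^ 2 - 2 * ρ * s * t by ring]
  split_ifs <;> first | rfl | (exfalso; linarith)

lemma sq_le_boundExponent {ρ s t : ℝ} (hρ0 : 0 ≤ ρ) (hρ1 : ρ < 1) :
    t ^ 2 / 2 ≤ boundExponent ρ s t ∨ (t ≤ ρ * s ∧ boundExponent ρ s t = s ^ 2 / 2) := by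
  have hr : 0 < 1 - ρ ^ 2 := by nlinarith
  unfold boundExponent
  split_ifs with h1 h2
  · exact Or.inl le_rfl
  · exact Or.inr ⟨h2, rfl⟩
  · left
    rw [div_le_div_iff₀ two_pos (by positivity)]
    -- s² + t² - 2ρst - (1 - ρ²) t² = (s - ρt)².
    nlinarith [sq_nonneg (s - ρ * t)]

lemma expansionBound_comm {ρ α β : ℝ} (hρ1 : ρ < 1) (hα : α ∈ Set.Ioo (0 : ℝ) 1)
    (hβ : β ∈ Set.Ioo (0 : ℝ) 1) : expansionBound ρ α β = expansionBound ρ β α := by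
  rw [expansionBound, expansionBound, if_neg (by linarith [hβ.1]), if_neg (by linarith [hα.1]),
    boundExponent_comm hρ1 (level_pos hα.1 hα.2) (level_pos hβ.1 hβ.2)]

lemma expansionBound_zero (ρ α : ℝ) : expansionBound ρ α 0 = 0 := by simp [expansionBound]

lemma expansionBound_nonneg (ρ α β : ℝ) : 0 ≤ expansionBound ρ α β := by
  unfold expansionBound; split_ifs
  · rfl
  · positivity

lemma expansionBound_le {ρ α β : ℝ} (hρ0 : 0 ≤ ρ) (hρ1 : ρ < 1) (hβ : β ∈ Set.Icc (0 : ℝ) 1) :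
    expansionBound ρ α β ≤ β := by
  rcases hβ.1.eq_or_lt with rfl | h0
  · simp [expansionBound]
  rw [expansionBound, if_neg (by linarith)]
  conv_rhs => rw [← exp_neg_level_sq h0 hβ.2]
  rw [Real.exp_le_exp, neg_le_neg_iff]
  rcases sq_le_boundExponent (t := level β) hρ0 hρ1 (s := level α) with h | ⟨h1, h2⟩
  · exact h
  · rw [h2]
    have : ρ * level α ≤ level α := by nlinarith [level_nonneg α]
    have := pow_le_pow_left₀ (level_nonneg β) (h1.trans this) 2
    linarith

lemma continuous_boundExponent {ρ s : ℝ} (hρ0 : 0 ≤ ρ) (hρ1 : ρ < 1) (hs : 0 < s) :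
    Continuous (boundExponent ρ s) := by
  have hr : 0 < 1 - ρ ^ 2 := by nlinarith
  unfold boundExponent
  refine Continuous.if_le (by fun_prop) (Continuous.if_le (by fun_prop) (by fun_prop)
    (by fun_prop) (by fun_prop) ?_) (by fun_prop) (by fun_prop) ?_
  · rintro t rfl
    field_simp
    ring
  · rintro t rfl
    have h0 : 0 < t := pos_of_mul_pos_right hs hρ0
    rw [if_neg (by nlinarith [mul_pos h0 hr])]
    field_simp
    ring

lemma continuousAt_level {β : ℝ} (h : β ≠ 0) : ContinuousAt level β :=
  Real.continuous_sqrt.continuousAt.comp ((Real.continuousAt_log h).const_mul (-2))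

lemma hasDerivAt_level {β : ℝ} (h0 : 0 < β) (h1 : β < 1) :
    HasDerivAt level (-1 / (β * level β)) β := by
  have h2 : -2 * Real.log β ≠ 0 := by have := Real.log_neg h0 h1; linarith
  have := ((Real.hasDerivAt_log h0.ne').const_mul (-2)).sqrt h2
  refine this.congr_deriv ?_
  rw [← level]
  have := (level_pos h0 h1).ne'
  field_simp

lemma continuousOn_expansionBound {ρ α : ℝ} (hρ0 : 0 ≤ ρ) (hρ1 : ρ < 1)
    (hα : α ∈ Set.Ioo (0 : ℝ) 1) : ContinuousOn (expansionBound ρ α) (Set.Icc 0 1) := by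
  intro β hβ
  rcases hβ.1.eq_or_lt with rfl | h0
  -- At 0 the exponential formula is unavailable; continuity follows by squeezing between 0 and β.
  · rw [ContinuousWithinAt, expansionBound_zero]
    refine tendsto_of_tendsto_of_tendsto_of_le_of_le' tendsto_const_nhds
      (Filter.tendsto_id.mono_left nhdsWithin_le_nhds)
      (Filter.Eventually.of_forall fun x => expansionBound_nonneg _ _ _) ?_
    filter_upwards [self_mem_nhdsWithin] with x hx
    exact expansionBound_le hρ0 hρ1 hx
  · refine ContinuousAt.continuousWithinAt ?_
    have hc : ContinuousAt (fun β => Real.exp (-boundExponent ρ (level α) (level β))) β :=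
      Real.continuous_exp.continuousAt.comp
        (((continuous_boundExponent hρ0 hρ1 (level_pos hα.1 hα.2)).continuousAt.comp
          (continuousAt_level h0.ne')).neg)
    refine hc.congr ?_
    filter_upwards [lt_mem_nhds h0] with x hx
    rw [expansionBound, if_neg (by linarith)]

lemma hasDerivAt_expansionBound {ρ α β : ℝ} (hρ0 : 0 ≤ ρ) (hρ1 : ρ < 1)
    (hα : α ∈ Set.Ioo (0 : ℝ) 1) (hβ : β ∈ Set.Ioo (0 : ℝ) 1)
    (h1 : level α ≠ ρ * level β) (h2 : level β ≠ ρ * level α) :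
    HasDerivAt (expansionBound ρ α) (slope ρ (level α) (level β)) β := by
  have hr : 0 < 1 - ρ ^ 2 := by nlinarith
  have ht := level_pos hβ.1 hβ.2
  have hs := level_pos hα.1 hα.2
  have hexp := exp_neg_level_sq hβ.1 hβ.2.le
  have key : ∀ {e' : ℝ}, HasDerivAt (boundExponent ρ (level α)) e' (level β) →
      HasDerivAt (expansionBound ρ α)
        (Real.exp (-boundExponent ρ (level α) (level β)) * e' / (β * level β)) β := by
    intro e' he
    have := ((he.comp β (hasDerivAt_level hβ.1 hβ.2)).neg).exp
    refine (this.congr_of_eventuallyEq ?_).congr_deriv ?_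
    · filter_upwards [lt_mem_nhds hβ.1] with x hx
      rw [expansionBound, if_neg (by linarith)]
      rfl
    · simp only [Pi.neg_apply, Function.comp]
      field_simp
  generalize level α = s at *
  generalize level β = t at *
  have c1 : Continuous fun t : ℝ => ρ * t := by fun_prop
  rcases h1.lt_or_gt with h1 | h1
  · have ev : ∀ᶠ x in nhds t, boundExponent ρ s x = x ^ 2 / 2 := by
      filter_upwards [c1.continuousAt.eventually (lt_mem_nhds h1)] with x hx
      rw [boundExponent, if_pos hx.le]
    have d := (((hasDerivAt_pow 2 t).div_const 2).congr_of_eventuallyEq ev)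
    refine (key d).congr_deriv ?_
    rw [ev.self_of_nhds, hexp, slope, if_neg (by rintro ⟨-, h⟩; linarith), if_neg (by nlinarith)]
    have := hβ.1.ne'
    field_simp
    simp
  rcases h2.lt_or_gt with h2 | h2
  · have ev : ∀ᶠ x in nhds t, boundExponent ρ s x = s ^ 2 / 2 := by
      filter_upwards [gt_mem_nhds h2, c1.continuousAt.eventually (gt_mem_nhds h1)] with x hx hx'
      rw [boundExponent, if_neg hx'.not_ge, if_pos hx.le]
    have d := ((hasDerivAt_const t (s ^ 2 / 2)).congr_of_eventuallyEq ev)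
    refine (key d).congr_deriv ?_
    rw [slope, if_neg (by rintro ⟨h, -⟩; linarith), if_pos h2.le]
    simp
  · have ev : ∀ᶠ x in nhds t, boundExponent ρ s x =
        (s ^ 2 + x ^ 2 - 2 * ρ * s * x) / (2 * (1 - ρ ^ 2)) := by
      filter_upwards [lt_mem_nhds h2, c1.continuousAt.eventually (gt_mem_nhds h1)] with x hx hx'
      rw [boundExponent, if_neg hx'.not_ge, if_neg hx.not_ge]
    have d := ((((hasDerivAt_pow 2 t).const_add (s ^ 2)).sub
      ((hasDerivAt_id t).const_mul (2 * ρ * s))).div_const (2 * (1 - ρ ^ 2))).congr_of_eventuallyEq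
        (ev.mono fun x hx => by simpa using hx)
    refine (key d).congr_deriv ?_
    rw [ev.self_of_nhds, slope, if_pos ⟨h2.le, h1.le⟩, branch]
    have e1 : Real.exp (t ^ 2 / 2) * β = 1 := by
      conv_lhs => rw [← hexp, ← Real.exp_add]
      simp
    rw [sub_eq_add_neg (t ^ 2 / 2), Real.exp_add]
    have := hβ.1.ne'
    field_simp
    push_cast
    linear_combination (-2 * (t - s * ρ)) * e1

lemma measurable_slope (ρ s : ℝ) : Measurable fun u => slope ρ s (level u) := by
  classical
  have hl := measurable_level
  have hb := measurable_branch ρ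
  unfold slope
  have m : ∀ {f g : ℝ → ℝ}, Measurable f → Measurable g → MeasurableSet {x | f x ≤ g x} :=
    fun hf hg => measurableSet_le hf hg
  refine Measurable.ite ?_ (by fun_prop) (Measurable.ite (m (by fun_prop) (by fun_prop)) (by fun_prop) (by fun_prop))
  exact (m (by fun_prop) (by fun_prop)).inter (m (by fun_prop) (by fun_prop))

lemma slope_mem_Icc {ρ s t : ℝ} (hρ : ρ ∈ Set.Icc (0 : ℝ) 1) (ht : 0 ≤ t) :
    slope ρ s t ∈ Set.Icc (0 : ℝ) 1 := by
  unfold slope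
  split_ifs with h
  · exact branch_mem_Icc hρ.1 hρ.2 ht h.1 h.2
  · simp
  · simp

lemma intervalIntegrable_of_mem_Icc {g : ℝ → ℝ} (hg : Measurable g)
    (h : ∀ x, g x ∈ Set.Icc (0 : ℝ) 1) (a b : ℝ) :
    IntervalIntegrable g MeasureTheory.volume a b := by
  refine (intervalIntegrable_const (c := (1 : ℝ))).mono_fun hg.aestronglyMeasurable
    (Filter.Eventually.of_forall fun x => ?_)
  simp only [Real.norm_eq_abs, abs_of_nonneg (h x).1, abs_one]
  exact (h x).2

lemma integral_slope {ρ α : ℝ} (hρ0 : 0 ≤ ρ) (hρ1 : ρ < 1) (hα : α ∈ Set.Ioo (0 : ℝ) 1)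
    {a b : ℝ} (ha : 0 ≤ a) (hab : a ≤ b) (hb : b ≤ 1) :
    ∫ u in a..b, slope ρ (level α) (level u) = expansionBound ρ α b - expansionBound ρ α a := by
  have inj : Set.InjOn level (Set.Ioo 0 1) := by
    intro x hx y hy h
    by_contra hne
    rcases lt_or_gt_of_ne hne with h' | h'
    · exact (level_lt_level hx.1 h' hy.2.le).ne' h
    · exact (level_lt_level hy.1 h' hx.2.le).ne h
  have hs := level_pos hα.1 hα.2
  -- The regime boundaries; `level` is injective on (0, 1), so at most two points are excluded from
  -- the fundamental theorem of calculus.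
  set E : Set ℝ := {u ∈ Set.Ioo 0 1 | level u = level α / ρ ∨ level u = ρ * level α} with hE
  have hEc : E.Countable := by
    refine Set.Countable.mono (s₂ := Set.Ioo 0 1 ∩ level ⁻¹' {level α / ρ, ρ * level α}) ?_ ?_
    · rintro u ⟨h1, h2⟩
      exact ⟨h1, by simpa using h2⟩
    · exact Set.MapsTo.countable_of_injOn (t := {level α / ρ, ρ * level α}) (fun u hu => hu.2)
        (inj.mono Set.inter_subset_left) (Set.to_countable _)
  refine MeasureTheory.integral_eq_of_hasDerivAt_off_countable_of_le _ _ hab hEc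
    ((continuousOn_expansionBound hρ0 hρ1 hα).mono (Set.Icc_subset_Icc ha hb)) ?_
    (intervalIntegrable_of_mem_Icc (measurable_slope _ _)
      (fun u => slope_mem_Icc ⟨hρ0, hρ1.le⟩ (level_nonneg _)) _ _)
  rintro u ⟨⟨hu1, hu2⟩, hu3⟩
  have hu : u ∈ Set.Ioo (0 : ℝ) 1 := ⟨by linarith, by linarith⟩
  refine hasDerivAt_expansionBound hρ0 hρ1 hα hu (fun h => hu3 ⟨hu, Or.inl ?_⟩)
    (fun h => hu3 ⟨hu, Or.inr h⟩)
  rcases hρ0.eq_or_lt with rfl | h0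
  · linarith
  · rw [h]; field_simp

lemma integral_theta_of_le {ρ α b : ℝ} (hρ0 : 0 ≤ ρ) (hρ1 : ρ < 1) (hα : α ∈ Set.Ioo (0 : ℝ) 1)
    (hb : 0 ≤ b) (h : b ≤ 1 - α) : ∫ u in (0 : ℝ)..b, theta ρ α u = expansionBound ρ α b := by
  rw [intervalIntegral.integral_congr_Ioo_of_le (g := fun u => slope ρ (level α) (level u)) hb,
    integral_slope hρ0 hρ1 hα le_rfl hb (by linarith [hα.1]), expansionBound_zero, sub_zero]
  intro u hu
  exact theta_of_add_lt_one hρ0 hρ1 hα.1 hu.1 (by linarith [hu.2])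

/-- Beyond 1 - α, θ is one minus the slope of the complementary problem. The two boundary terms at 1
- α cancel by symmetry of the expansion bound. -/
lemma integral_theta_of_ge {ρ α b : ℝ} (hρ0 : 0 ≤ ρ) (hρ1 : ρ < 1) (hα : α ∈ Set.Ioo (0 : ℝ) 1)
    (hb : b ≤ 1) (h : 1 - α ≤ b) :
    ∫ u in (0 : ℝ)..b, theta ρ α u = α + b - 1 + expansionBound ρ (1 - α) (1 - b) := by
  have hi := intervalIntegrable_of_mem_Icc (measurable_theta ρ α)
    (fun u => theta_mem_Icc ⟨hρ0, hρ1.le⟩ α u)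
  have hα' : 1 - α ∈ Set.Ioo (0 : ℝ) 1 := ⟨by linarith [hα.2], by linarith [hα.1]⟩
  rw [← intervalIntegral.integral_add_adjacent_intervals (hi 0 (1 - α)) (hi (1 - α) b),
    integral_theta_of_le hρ0 hρ1 hα (by linarith [hα.2]) le_rfl,
    intervalIntegral.integral_congr_Ioo_of_le
      (g := fun u => 1 - slope ρ (level (1 - α)) (level (1 - u))) h,
    intervalIntegral.integral_comp_sub_left
      (fun u => 1 - slope ρ (level (1 - α)) (level u)) 1,
    intervalIntegral.integral_sub intervalIntegrable_const
      (intervalIntegrable_of_mem_Icc (measurable_slope _ _)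
        (fun u => slope_mem_Icc ⟨hρ0, hρ1.le⟩ (level_nonneg _)) _ _),
    integral_slope hρ0 hρ1 hα' (by linarith) (by linarith) (by linarith [hα.2]),
    sub_sub_cancel, expansionBound_comm hρ1 hα hα']
  · simp
    ring
  · intro u hu
    exact theta_of_one_lt_add hρ0 hρ1 hα.2 (by linarith [hu.2]) (by linarith [hu.1])

/-! ### Generalized small-set expansion -/

/-- For these exponents β^(1/p) α^(1/q) is exactly the interior expression of the expansion bound;
the strict inequalities on levels make both exponents admissible. -/
lemma twoFunction_level {ρ s t : ℝ} (hρ0 : 0 ≤ ρ) (hρ1 : ρ < 1) (hs : 0 < s) (ht : 0 < t)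
    (h1 : ρ * t < s) (h2 : ρ * s < t) :
    TwoFunction ρ ((1 - ρ ^ 2) * t / (t - ρ * s)) ((1 - ρ ^ 2) * s / (s - ρ * t)) := by
  rcases hρ0.eq_or_lt with rfl | hρ0
  · simpa [hs.ne', ht.ne'] using twoFunction_zero
  have k1 : 0 < t - ρ * s := by linarith
  have k2 : 0 < s - ρ * t := by linarith
  have e1 : (1 - ρ ^ 2) * t / (t - ρ * s) - 1 = ρ * (s - ρ * t) / (t - ρ * s) := by
    field_simp; ring
  have e2 : (1 - ρ ^ 2) * s / (s - ρ * t) - 1 = ρ * (t - ρ * s) / (s - ρ * t) := by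
    field_simp; ring
  have p1 : 0 < ρ * (s - ρ * t) / (t - ρ * s) := by positivity
  have p2 : 0 < ρ * (t - ρ * s) / (s - ρ * t) := by positivity
  refine twoFunction_of_lt_one (by linarith) (by linarith) hρ0 hρ1 ?_
  rw [e1, e2]
  field_simp

section

variable {ι : Type} [Fintype ι] [DecidableEq ι]

lemma sum_le_card_of_mem_Icc {ρ : ℝ} (hρ : ρ ∈ Set.Icc (0 : ℝ) 1) {f : Cube ι → ℝ}
    (hf : ∀ x, f x ∈ Set.Icc (0 : ℝ) 1) (B : Finset (Cube ι)) :
    ∑ x ∈ B, cubeNoise ρ f x ≤ B.card := by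
  rw [Finset.cast_card]
  exact Finset.sum_le_sum fun x _ => (cubeNoise_mem_Icc hρ hf x).2

lemma sum_cubeNoise_le_sum {ρ : ℝ} (hρ : ρ ∈ Set.Icc (0 : ℝ) 1) {f : Cube ι → ℝ}
    (hf : ∀ x, f x ∈ Set.Icc (0 : ℝ) 1) (B : Finset (Cube ι)) :
    ∑ x ∈ B, cubeNoise ρ f x ≤ ∑ x, f x := by
  rw [← sum_cubeNoise ρ f]
  exact Finset.sum_le_sum_of_subset_of_nonneg (Finset.subset_univ _)
    fun x _ _ => (cubeNoise_mem_Icc hρ hf x).1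

/-- The generalized small-set expansion theorem. -/
lemma sum_cubeNoise_le_expansionBound {ρ α β : ℝ} (hρ0 : 0 ≤ ρ) (hρ1 : ρ < 1) {f : Cube ι → ℝ}
    (hf : ∀ x, f x = 0 ∨ f x = 1) (B : Finset (Cube ι))
    (hα : (∑ x, f x) / 2 ^ Fintype.card ι = α) (hβ : (B.card : ℝ) / 2 ^ Fintype.card ι = β)
    (hα0 : 0 < α) (hα1 : α < 1) (hβ1 : β ≤ 1) :
    (∑ x ∈ B, cubeNoise ρ f x) / 2 ^ Fintype.card ι ≤ expansionBound ρ α β := by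
  have hρ : ρ ∈ Set.Icc (0 : ℝ) 1 := ⟨hρ0, hρ1.le⟩
  have hf' : ∀ x, f x ∈ Set.Icc (0 : ℝ) 1 := fun x => by rcases hf x with h | h <;> simp [h]
  have hN : (0 : ℝ) < 2 ^ Fintype.card ι := by positivity
  rcases B.eq_empty_or_nonempty with rfl | hB
  · simpa using expansionBound_nonneg ρ α β
  have hβ0 : 0 < β := by
    rw [← hβ]; exact div_pos (by exact_mod_cast hB.card_pos) hN
  rw [expansionBound, if_neg hβ0.not_ge, boundExponent]
  split_ifs with h1 h2
  · rw [exp_neg_level_sq hβ0 hβ1, ← hβ]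
    gcongr
    exact sum_le_card_of_mem_Icc hρ hf' B
  · rw [exp_neg_level_sq hα0 hα1.le, ← hα]
    gcongr
    exact sum_cubeNoise_le_sum hρ hf' B
  push Not at h1 h2
  have hs := level_pos hα0 hα1
  have ht : 0 < level β := lt_of_le_of_lt (by positivity) h2
  have ea := exp_neg_level_sq hα0 hα1.le
  have eb := exp_neg_level_sq hβ0 hβ1
  have tf := twoFunction_level hρ0 hρ1 hs ht h1 h2
  have hr : 0 < 1 - ρ ^ 2 := by nlinarith
  have k1 : 0 < level β - ρ * level α := by linarith
  have k2 : 0 < level α - ρ * level β := by linarith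
  have hP : 0 < (1 - ρ ^ 2) * level β / (level β - ρ * level α) := by positivity
  have hQ : 0 < (1 - ρ ^ 2) * level α / (level α - ρ * level β) := by positivity
  -- Both functions are 0-1 valued, so the powers in the norms disappear and only the measures β and
  -- α remain.
  have key := tf.cube hρ hP hQ (F := fun x => if x ∈ B then 1 else 0) (G := f)
    (fun x => by split_ifs <;> norm_num) (fun x => (hf' x).1)
  have f1 : ∀ x, f x ^ ((1 - ρ ^ 2) * level α / (level α - ρ * level β)) = f x := fun x => by
    rcases hf x with h | h <;> simp [h, hQ.ne']
  have f2 : ∀ x, (if x ∈ B then (1 : ℝ) else 0) ^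
      ((1 - ρ ^ 2) * level β / (level β - ρ * level α)) = if x ∈ B then 1 else 0 := fun x => by
    split_ifs <;> simp [hP.ne']
  have f3 : ∑ x, ∑ y, cubeKernel ρ x y * ((if x ∈ B then 1 else 0) * f y) =
      ∑ x ∈ B, cubeNoise ρ f x := by
    rw [← Finset.sum_filter_add_sum_filter_not Finset.univ (· ∈ B)]
    simp only [Finset.filter_mem_eq_inter, Finset.univ_inter]
    rw [Finset.sum_congr rfl (g := cubeNoise ρ f), Finset.sum_eq_zero (s := Finset.filter _ _),
      add_zero]
    · intro x hx
      simp [(Finset.mem_filter.1 hx).2]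
    · intro x hx
      simp [hx, cubeNoise]
  have f4 : ∑ x, (if x ∈ B then (1 : ℝ) else 0) = B.card := by simp
  simp only [f1, f2, f3, f4, hα, hβ] at key
  refine key.trans (le_of_eq ?_)
  have ea' : ∀ c : ℝ, α ^ c = Real.exp (-(level α ^ 2 / 2) * c) := fun c => by
    rw [Real.exp_mul, ea]
  have eb' : ∀ c : ℝ, β ^ c = Real.exp (-(level β ^ 2 / 2) * c) := fun c => by
    rw [Real.exp_mul, eb]
  rw [ea', eb', ← Real.exp_add]
  congr 1
  field_simp
  ring

lemma integral_theta_one_noise {α b : ℝ} (hα : α ∈ Set.Ioo (0 : ℝ) 1) (hb0 : 0 ≤ b) (hb1 : b ≤ 1) :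
    ∫ u in (0 : ℝ)..b, theta 1 α u = min α b := by
  have h1 : ∀ c, 0 ≤ c → c ≤ α → ∫ u in (0 : ℝ)..c, theta 1 α u = c := by
    intro c hc hcα
    rw [intervalIntegral.integral_congr_Ioo_of_le (g := fun _ => (1 : ℝ)) hc]
    · simp
    · intro u hu
      exact theta_one_of_lt hα.2 hu.1 (hu.2.trans_le hcα)
  have hi := intervalIntegrable_of_mem_Icc (measurable_theta 1 α)
    (fun u => theta_mem_Icc (by simp) α u)
  rcases le_total b α with h | h
  · rw [min_eq_right h, h1 b hb0 h]
  · rw [min_eq_left h, ← intervalIntegral.integral_add_adjacent_intervals (hi 0 α) (hi α b),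
      h1 α hα.1.le le_rfl,
      intervalIntegral.integral_congr_Ioo_of_le (g := fun _ => (0 : ℝ)) h]
    · simp
    · intro u hu
      exact theta_one_of_gt hα.1 (hu.2.trans_le hb1) hu.1

lemma integral_theta {ρ α : ℝ} (hρ : ρ ∈ Set.Icc (0 : ℝ) 1) (hα : α ∈ Set.Icc (0 : ℝ) 1) :
    ∫ u in (0 : ℝ)..1, theta ρ α u = α := by
  rcases hα.1.eq_or_lt with rfl | h0
  · simp [theta]
  rcases hα.2.eq_or_lt with rfl | h1
  · simp [theta]
  rcases hρ.2.eq_or_lt with rfl | hρ1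
  · rw [integral_theta_one_noise ⟨h0, h1⟩ zero_le_one le_rfl, min_eq_left h1.le]
  · rw [integral_theta_of_ge hρ.1 hρ1 ⟨h0, h1⟩ le_rfl (by linarith), sub_self,
      expansionBound_zero]
    ring

lemma sum_cubeNoise_eq_compl (ρ : ℝ) (f : Cube ι → ℝ) (B : Finset (Cube ι)) :
    ∑ x ∈ B, cubeNoise ρ f x =
      ∑ x, f x - (Bᶜ.card : ℝ) + ∑ x ∈ Bᶜ, cubeNoise ρ (fun y => 1 - f y) x := by
  have h : ∀ x, cubeNoise ρ (fun y => 1 - f y) x = 1 - cubeNoise ρ f x := by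
    intro x
    simp only [cubeNoise, mul_sub, mul_one, Finset.sum_sub_distrib, sum_cubeKernel]
  simp only [h, Finset.sum_sub_distrib]
  rw [← sum_cubeNoise ρ f, ← Finset.sum_add_sum_compl B]
  simp

/-- The mass of `T_ρ f` on a set is at most the integral of `θ` over an interval of the same
measure. -/
lemma sum_cubeNoise_le_integral_theta {ρ : ℝ} (hρ : ρ ∈ Set.Icc (0 : ℝ) 1) {f : Cube ι → ℝ}
    (hf : ∀ x, f x = 0 ∨ f x = 1) (B : Finset (Cube ι)) :
    ∑ x ∈ B, cubeNoise ρ f x ≤ 2 ^ Fintype.card ι *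
      ∫ u in (0 : ℝ)..B.card / 2 ^ Fintype.card ι,
        theta ρ ((∑ x, f x) / 2 ^ Fintype.card ι) u := by
  have hf' : ∀ x, f x ∈ Set.Icc (0 : ℝ) 1 := fun x => by rcases hf x with h | h <;> simp [h]
  have hN : (0 : ℝ) < 2 ^ Fintype.card ι := by positivity
  have hcard : (Fintype.card (Cube ι) : ℝ) = 2 ^ Fintype.card ι := by simp
  have b1 := sum_le_card_of_mem_Icc hρ hf' B
  have b2 := sum_cubeNoise_le_sum hρ hf' B
  have hsum0 : 0 ≤ ∑ x, f x := Finset.sum_nonneg fun x _ => (hf' x).1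
  have hsum1 : ∑ x, f x ≤ 2 ^ Fintype.card ι := by
    rw [← hcard, ← Finset.card_univ, Finset.cast_card]
    exact Finset.sum_le_sum fun x _ => (hf' x).2
  have hB1 : (B.card : ℝ) ≤ 2 ^ Fintype.card ι := by
    rw [← hcard]; exact_mod_cast Finset.card_le_univ B
  have hC : (Bᶜ.card : ℝ) = 2 ^ Fintype.card ι - B.card := by
    rw [← hcard, Finset.card_compl, Nat.cast_sub (Finset.card_le_univ B)]
  have hC' := sum_cubeNoise_eq_compl ρ f B
  have hf1 : ∀ x, 1 - f x = 0 ∨ 1 - f x = 1 := fun x => by rcases hf x with h | h <;> simp [h]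
  have hsum' : ∑ x, (1 - f x) = 2 ^ Fintype.card ι - ∑ x, f x := by
    rw [Finset.sum_sub_distrib, ← hcard]; simp
  set N : ℝ := 2 ^ Fintype.card ι with hNdef
  set α := (∑ x, f x) / N with hα
  set β := (B.card : ℝ) / N with hβ
  have hβ0 : 0 ≤ β := by positivity
  have hβ1 : β ≤ 1 := (div_le_one hN).2 hB1
  have hα0 : 0 ≤ α := by positivity
  have hα1 : α ≤ 1 := (div_le_one hN).2 hsum1
  have eα : ∑ x, f x = N * α := by rw [hα, mul_div_cancel₀ _ hN.ne']
  have eβ : (B.card : ℝ) = N * β := by rw [hβ, mul_div_cancel₀ _ hN.ne']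
  rcases hα0.eq_or_lt with h0 | h0
  · rw [← h0] at eα ⊢
    simpa [theta, eα] using b2
  rcases hα1.eq_or_lt with h1 | h1
  · rw [h1]
    simpa [theta, eβ, not_le.2 one_pos] using b1
  -- For ρ = 1 the integral of θ is min α β, which is the minimum of the two trivial bounds.
  rcases hρ.2.eq_or_lt with h | hρ1
  · rw [h, integral_theta_one_noise ⟨h0, h1⟩ hβ0 hβ1, ← h]
    rcases min_choice α β with h | h <;> rw [h]
    · rwa [← eα]
    · rwa [← eβ]
  rcases le_total β (1 - α) with h | h
  · rw [integral_theta_of_le hρ.1 hρ1 ⟨h0, h1⟩ hβ0 h, ← div_le_iff₀' hN]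
    exact sum_cubeNoise_le_expansionBound hρ.1 hρ1 hf B hα.symm hβ.symm h0 h1 hβ1
  · rw [integral_theta_of_ge hρ.1 hρ1 ⟨h0, h1⟩ hβ1 h, hC', eα, hC, eβ]
    have := sum_cubeNoise_le_expansionBound (α := 1 - α) (β := 1 - β) hρ.1 hρ1 hf1 Bᶜ
      (by rw [hsum', ← hNdef, eα]; field_simp) (by rw [hC, ← hNdef, eβ]; field_simp)
      (by linarith) (by linarith) (by linarith)
    rw [div_le_iff₀' hN] at this
    linarith

end

/-! ### Majorization and convex functions -/

lemma exists_antitone_enumeration {X : Type} [Fintype X] [DecidableEq X] [Nonempty X] (g : X → ℝ) :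
    ∃ x : ℕ → X, Set.InjOn x (Finset.range (Fintype.card X)) ∧
      (Finset.range (Fintype.card X)).image x = Finset.univ ∧
      ∀ i j, i ≤ j → j < Fintype.card X → g (x j) ≤ g (x i) := by
  set e0 := (Fintype.equivFin X).symm
  set e := (Tuple.sort fun i => -g (e0 i)).trans e0 with he
  have hm : ∀ i j, i ≤ j → g (e j) ≤ g (e i) := fun i j hij =>
    neg_le_neg_iff.1 (Tuple.monotone_sort (fun i => -g (e0 i)) hij)
  set x : ℕ → X := fun i => if h : i < Fintype.card X then e ⟨i, h⟩ else Classical.arbitrary X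
    with hx
  have hxe : ∀ i (h : i < Fintype.card X), x i = e ⟨i, h⟩ := fun i h => by simp [hx, h]
  have inj : Set.InjOn x (Finset.range (Fintype.card X)) := by
    intro i hi j hj hij
    rw [Finset.mem_coe, Finset.mem_range] at hi hj
    rw [hxe i hi, hxe j hj] at hij
    simpa using e.injective hij
  refine ⟨x, inj, ?_, fun i j hij hj => ?_⟩
  · rw [← Finset.card_eq_iff_eq_univ, Finset.card_image_of_injOn inj, Finset.card_range]
  · rw [hxe i (hij.trans_lt hj), hxe j hj]
    exact hm _ _ hij

/-- Abel summation, by induction: lowering the coefficient of a nonnegative partial sum only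
decreases it. -/
lemma mul_sum_le_sum_mul {N : ℕ} {c d : ℕ → ℝ} (hc : ∀ i, i + 1 < N → c (i + 1) ≤ c i)
    (hd : ∀ j ≤ N, 0 ≤ ∑ i ∈ Finset.range j, d i) : ∀ m, m < N →
    c m * ∑ i ∈ Finset.range (m + 1), d i ≤ ∑ i ∈ Finset.range (m + 1), c i * d i := by
  intro m
  induction m with
  | zero => intro _; simp
  | succ m ih =>
    intro hm
    rw [Finset.sum_range_succ _ (m + 1), Finset.sum_range_succ _ (m + 1), mul_add]
    have h1 := ih (by omega)
    have h2 := mul_le_mul_of_nonneg_right (hc m hm) (hd (m + 1) hm.le)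
    linarith

/-- List the values of g in decreasing order and integrate the tangent-line bound at the i-th value
over [i/N, (i+1)/N]. The linear errors are c(g_i) d_i, where c(g_i) decreases in i and d has
nonnegative partial sums and total 0, so they sum to something nonnegative. -/
lemma sum_le_integral_of_subgradient {X : Type} [Fintype X] [Nonempty X] {Ψ c : ℝ → ℝ}
    (hc : ∀ y ∈ Set.Icc (0 : ℝ) 1, ∀ z ∈ Set.Icc (0 : ℝ) 1, Ψ y + c y * (z - y) ≤ Ψ z)
    {g : X → ℝ} (hg : ∀ x, g x ∈ Set.Icc (0 : ℝ) 1) {h : ℝ → ℝ} (hm : Measurable h)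
    (hh : ∀ u, h u ∈ Set.Icc (0 : ℝ) 1)
    (hΨ : ∀ a b, IntervalIntegrable (fun u => Ψ (h u)) MeasureTheory.volume a b)
    (hle : ∀ B : Finset X, ∑ x ∈ B, g x ≤
      Fintype.card X * ∫ u in (0 : ℝ)..B.card / Fintype.card X, h u)
    (heq : ∑ x, g x = Fintype.card X * ∫ u in (0 : ℝ)..1, h u) :
    (∑ x, Ψ (g x)) / Fintype.card X ≤ ∫ u in (0 : ℝ)..1, Ψ (h u) := by
  classical
  obtain ⟨x, inj, himg, hanti⟩ := exists_antitone_enumeration g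
  have hN0 : 0 < Fintype.card X := Fintype.card_pos
  have hsum : ∀ F : X → ℝ, ∑ y, F y = ∑ i ∈ Finset.range (Fintype.card X), F (x i) := by
    intro F
    rw [← himg, Finset.sum_image inj]
  have hsub : ∀ j ≤ Fintype.card X, ∑ i ∈ Finset.range j, g (x i) ≤
      Fintype.card X * ∫ u in (0 : ℝ)..j / Fintype.card X, h u := by
    intro j hj
    have inj' : Set.InjOn x (Finset.range j) := inj.mono (by
      intro i hi
      simp only [Finset.coe_range, Set.mem_Iio] at hi ⊢
      omega)
    have := hle ((Finset.range j).image x)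
    rwa [Finset.sum_image inj', Finset.card_image_of_injOn inj', Finset.card_range] at this
  rw [hsum] at heq ⊢
  set N := Fintype.card X
  have hN : (0 : ℝ) < N := by exact_mod_cast hN0
  have hi := intervalIntegrable_of_mem_Icc hm hh
  have adj : ∀ {k : ℝ → ℝ}, (∀ a b, IntervalIntegrable k MeasureTheory.volume a b) → ∀ j : ℕ,
      ∑ i ∈ Finset.range j, ∫ u in (i / N : ℝ)..((i + 1 : ℕ) / N : ℝ), k u =
        ∫ u in (0 : ℝ)..j / N, k u := by
    intro k hk j
    have := intervalIntegral.sum_integral_adjacent_intervals (a := fun i : ℕ => (i / N : ℝ))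
      (n := j) (f := k) (μ := MeasureTheory.volume) fun i _ => hk _ _
    simpa using this
  set d : ℕ → ℝ := fun i => (∫ u in (i / N : ℝ)..((i + 1 : ℕ) / N : ℝ), h u) - g (x i) / N with hd
  have hdsum : ∀ j, ∑ i ∈ Finset.range j, d i = (∫ u in (0 : ℝ)..j / N, h u) -
      (∑ i ∈ Finset.range j, g (x i)) / N := by
    intro j
    rw [hd, Finset.sum_sub_distrib, adj hi, Finset.sum_div]
  have hd0 : ∀ j ≤ N, 0 ≤ ∑ i ∈ Finset.range j, d i := by
    intro j hj
    rw [hdsum, sub_nonneg, div_le_iff₀' hN]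
    exact hsub j hj
  have hdN : ∑ i ∈ Finset.range N, d i = 0 := by
    rw [hdsum, heq, div_self hN.ne', mul_div_cancel_left₀ _ hN.ne', sub_self]
  have hcanti : ∀ i, i + 1 < N → c (g (x (i + 1))) ≤ c (g (x i)) := by
    intro i hiN
    rcases (hanti i (i + 1) (by omega) hiN).eq_or_lt with h' | h'
    · rw [h']
    -- Adding the two subgradient inequalities shows that c is monotone.
    · have h1 := hc _ (hg (x (i + 1))) _ (hg (x i))
      have h2 := hc _ (hg (x i)) _ (hg (x (i + 1)))
      nlinarith
  have key : 0 ≤ ∑ i ∈ Finset.range N, c (g (x i)) * d i := by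
    have := mul_sum_le_sum_mul (c := fun i => c (g (x i))) hcanti hd0 (N - 1) (by omega)
    rwa [Nat.sub_add_cancel hN0, hdN, mul_zero] at this
  have piece : ∀ i : ℕ, Ψ (g (x i)) / N + c (g (x i)) * d i ≤
      ∫ u in (i / N : ℝ)..((i + 1 : ℕ) / N : ℝ), Ψ (h u) := by
    intro i
    have hlen : ((i + 1 : ℕ) / N : ℝ) - i / N = 1 / N := by push_cast; ring
    have hle' : (i / N : ℝ) ≤ ((i + 1 : ℕ) / N : ℝ) := by
      have : (0 : ℝ) ≤ 1 / N := by positivity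
      linarith
    calc Ψ (g (x i)) / N + c (g (x i)) * d i
        = ∫ u in (i / N : ℝ)..((i + 1 : ℕ) / N : ℝ),
            (Ψ (g (x i)) + c (g (x i)) * (h u - g (x i))) := by
          rw [intervalIntegral.integral_add intervalIntegrable_const
            (((hi _ _).sub intervalIntegrable_const).const_mul _),
            intervalIntegral.integral_const_mul,
            intervalIntegral.integral_sub (hi _ _) intervalIntegrable_const]
          simp only [intervalIntegral.integral_const, hlen, hd, smul_eq_mul]
          ring
      _ ≤ _ := by
          refine intervalIntegral.integral_mono_on hle' (intervalIntegrable_const.add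
            (((hi _ _).sub intervalIntegrable_const).const_mul _)) (hΨ _ _) fun u _ => ?_
          exact hc _ (hg _) _ (hh u)
  have := Finset.sum_le_sum fun i (_ : i ∈ Finset.range N) => piece i
  rw [adj hΨ, div_self hN.ne', Finset.sum_add_distrib, ← Finset.sum_div] at this
  linarith

lemma exists_subgradient {Φ : ℝ → ℝ} (hΦ : ConvexOn ℝ (Set.Icc 0 1) Φ) {y z : ℝ}
    (hy : y ∈ Set.Ioo (0 : ℝ) 1) (hz : z ∈ Set.Icc (0 : ℝ) 1) :
    Φ y + derivWithin Φ (Set.Ioi y) y * (z - y) ≤ Φ z := by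
  have hyi : y ∈ interior (Set.Icc (0 : ℝ) 1) := by rwa [interior_Icc]
  have hy' := interior_subset hyi
  rcases lt_trichotomy y z with h | rfl | h
  · have := hΦ.rightDeriv_le_slope_of_mem_interior hyi hz h
    rw [slope_def_field, le_div_iff₀ (by linarith)] at this
    linarith
  · simp
  · have h1 := hΦ.slope_le_leftDeriv_of_mem_interior hz hyi h
    have h2 := hΦ.leftDeriv_le_rightDeriv_of_mem_interior hyi
    have := h1.trans h2
    rw [slope_def_field, div_le_iff₀ (by linarith)] at this
    linarith

lemma intervalIntegrable_comp_of_mem_Icc {Φ : ℝ → ℝ} (hΦ : ContinuousOn Φ (Set.Icc 0 1))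
    {h : ℝ → ℝ} (hm : Measurable h) (hh : ∀ u, h u ∈ Set.Icc (0 : ℝ) 1) (a b : ℝ) :
    IntervalIntegrable (fun u => Φ (h u)) MeasureTheory.volume a b := by
  obtain ⟨C, hC⟩ := isCompact_Icc.exists_bound_of_continuousOn hΦ
  -- Φ is arbitrary outside [0, 1], so measurability goes through its continuous extension from that
  -- interval.
  have he : (fun u => Φ (h u)) =
      Set.IccExtend zero_le_one ((Set.Icc (0 : ℝ) 1).domRestrict Φ) ∘ h := by
    ext u
    rw [Function.comp, Set.IccExtend_of_mem _ _ (hh u)]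
    rfl
  have hmeas : Measurable fun u => Φ (h u) := by
    rw [he]
    exact (continuousOn_iff_continuous_domRestrict.1 hΦ).Icc_extend'.measurable.comp hm
  refine (intervalIntegrable_const (c := C)).mono_fun hmeas.aestronglyMeasurable
    (Filter.Eventually.of_forall fun u => ?_)
  exact (hC _ (hh u)).trans (le_abs_self C)

/-- A finite version of the Hardy-Littlewood-Pólya majorization inequality. -/
lemma sum_le_integral_of_convexOn {X : Type} [Fintype X] [Nonempty X] {Φ : ℝ → ℝ}
    (hΦc : ContinuousOn Φ (Set.Icc 0 1)) (hΦ : ConvexOn ℝ (Set.Icc 0 1) Φ)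
    {g : X → ℝ} (hg : ∀ x, g x ∈ Set.Icc (0 : ℝ) 1) {h : ℝ → ℝ} (hm : Measurable h)
    (hh : ∀ u, h u ∈ Set.Icc (0 : ℝ) 1)
    (hle : ∀ B : Finset X, ∑ x ∈ B, g x ≤
      Fintype.card X * ∫ u in (0 : ℝ)..B.card / Fintype.card X, h u)
    (heq : ∑ x, g x = Fintype.card X * ∫ u in (0 : ℝ)..1, h u) :
    (∑ x, Φ (g x)) / Fintype.card X ≤ ∫ u in (0 : ℝ)..1, Φ (h u) := by
  have half : (1 / 2 : ℝ) ∈ Set.Icc (0 : ℝ) 1 := by norm_num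
  -- Φ may have infinite slope at 0 or 1 and hence no subgradient there. Values are contracted
  -- towards 1/2, and δ → 0 at the end.
  have shrink : ∀ {δ z : ℝ}, δ ∈ Set.Ioo (0 : ℝ) 1 → z ∈ Set.Icc (0 : ℝ) 1 →
      (1 - δ) * z + δ * (1 / 2) ∈ Set.Ioo (0 : ℝ) 1 := by
    rintro δ z ⟨h1, h2⟩ ⟨h3, h4⟩
    constructor <;> nlinarith
  have hint := intervalIntegrable_comp_of_mem_Icc hΦc hm hh
  have step : ∀ δ ∈ Set.Ioo (0 : ℝ) 1,
      (∑ x, Φ ((1 - δ) * g x + δ * (1 / 2))) / Fintype.card X ≤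
        (1 - δ) * (∫ u in (0 : ℝ)..1, Φ (h u)) + δ * Φ (1 / 2) := by
    intro δ hδ
    have hint' := intervalIntegrable_comp_of_mem_Icc hΦc
      (h := fun u => (1 - δ) * h u + δ * (1 / 2)) (by fun_prop)
      fun u => Set.Ioo_subset_Icc_self (shrink hδ (hh u))
    refine (sum_le_integral_of_subgradient (Ψ := fun z => Φ ((1 - δ) * z + δ * (1 / 2)))
      (c := fun z => (1 - δ) * derivWithin Φ (Set.Ioi ((1 - δ) * z + δ * (1 / 2)))
        ((1 - δ) * z + δ * (1 / 2))) ?_ hg hm hh hint' hle heq).trans ?_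
    · intro y hy z hz
      have := exists_subgradient hΦ (shrink hδ hy) (Set.Ioo_subset_Icc_self (shrink hδ hz))
      refine le_trans (le_of_eq ?_) this
      ring
    · have e : (1 - δ) * (∫ u in (0 : ℝ)..1, Φ (h u)) + δ * Φ (1 / 2) =
          ∫ u in (0 : ℝ)..1, ((1 - δ) * Φ (h u) + δ * Φ (1 / 2)) := by
        rw [intervalIntegral.integral_add ((hint _ _).const_mul _) intervalIntegrable_const,
          intervalIntegral.integral_const_mul]
        simp
      rw [e]
      refine intervalIntegral.integral_mono_on zero_le_one (hint' _ _)
        (((hint _ _).const_mul _).add intervalIntegrable_const) fun u _ => ?_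
      simpa using hΦ.2 (hh u) half (by linarith [hδ.2] : 0 ≤ 1 - δ) hδ.1.le (by ring)
  have ev : ∀ᶠ δ in nhdsWithin (0 : ℝ) (Set.Ioi 0), δ ∈ Set.Ioo (0 : ℝ) 1 :=
    Ioo_mem_nhdsGT one_pos
  have l1 : Filter.Tendsto (fun δ : ℝ => (∑ x, Φ ((1 - δ) * g x + δ * (1 / 2))) / Fintype.card X)
      (nhdsWithin 0 (Set.Ioi 0)) (nhds ((∑ x, Φ (g x)) / Fintype.card X)) := by
    refine (tendsto_finsetSum _ fun x _ => ?_).div_const _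
    refine (hΦc (g x) (hg x)).tendsto.comp (tendsto_nhdsWithin_iff.2 ⟨?_, ?_⟩)
    · have : Continuous fun δ : ℝ => (1 - δ) * g x + δ * (1 / 2) := by fun_prop
      simpa using (this.tendsto 0).mono_left nhdsWithin_le_nhds
    · filter_upwards [ev] with δ hδ
      exact Set.Ioo_subset_Icc_self (shrink hδ (hg x))
  have l2 : Filter.Tendsto (fun δ : ℝ => (1 - δ) * (∫ u in (0 : ℝ)..1, Φ (h u)) + δ * Φ (1 / 2))
      (nhdsWithin 0 (Set.Ioi 0)) (nhds (∫ u in (0 : ℝ)..1, Φ (h u))) := by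
    have : Continuous fun δ : ℝ => (1 - δ) * (∫ u in (0 : ℝ)..1, Φ (h u)) + δ * Φ (1 / 2) := by
      fun_prop
    simpa using (this.tendsto 0).mono_left nhdsWithin_le_nhds
  exact le_of_tendsto_of_tendsto l1 l2 (ev.mono step)

/-! ### Decomposition into subcubes -/

lemma hammingDist_weight_eq_cubeKernel (ρ : ℝ) {ι : Type} [Fintype ι] (a b : Cube ι) :
    ((1 + ρ) / 2) ^ (Fintype.card ι - hammingDist b a) * ((1 - ρ) / 2) ^ hammingDist b a =
      cubeKernel ρ a b := by
  have h : (Finset.univ.filter fun i => b i = a i).card + hammingDist b a = Fintype.card ι := by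
    rw [← Finset.card_univ]
    exact Finset.card_filter_add_card_filter_not _
  simp only [cubeKernel, bitKernel]
  rw [Finset.prod_ite, Finset.prod_const, Finset.prod_const, ← h, Nat.add_sub_cancel]
  rfl

variable {n : ℕ} (S : Finset (Fin n))

/-- The decomposition of the cube into the subcubes `{x_S = a}`. -/
def cubeSplit : Cube (Fin n) ≃ Cube S × Cube {i // i ∉ S} :=
  Equiv.piEquivPiSubtypeProd (· ∈ S) fun _ => ℤˣ

/-- The restriction of `f` to the subcube `{x_S = a}`. -/
def restrictCube (f : Cube (Fin n) → ℝ) (a : Cube S) (x : Cube {i // i ∉ S}) : ℝ :=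
  f ((cubeSplit S).symm (a, x))

lemma sum_eq_sum_restrictCube (f : Cube (Fin n) → ℝ) :
    ∑ x, f x = ∑ a, ∑ x, restrictCube S f a x := by
  rw [← Fintype.sum_prod_type', ← (cubeSplit S).symm.sum_comp]
  rfl

lemma cubeKernel_split (ρ : ℝ) (x y : Cube (Fin n)) :
    cubeKernel ρ x y = cubeKernel ρ (cubeSplit S x).1 (cubeSplit S y).1 *
      cubeKernel ρ (cubeSplit S x).2 (cubeSplit S y).2 := by
  simp only [cubeKernel]
  rw [← Fintype.prod_subtype_mul_prod_subtype (· ∈ S)]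
  congr 1
  convert! rfl

lemma restrictCube_noiseOp (ρ : ℝ) (f : Cube (Fin n) → ℝ) (a : Cube S) (x : Cube {i // i ∉ S}) :
    restrictCube S (noiseOp ρ f) a x =
      ∑ b, cubeKernel ρ a b * cubeNoise ρ (restrictCube S f b) x := by
  -- `noiseKernel` and `cubeKernel` agree by definition.
  change ∑ y, cubeKernel ρ ((cubeSplit S).symm (a, x)) y * f y = _
  rw [sum_eq_sum_restrictCube S]
  refine Finset.sum_congr rfl fun b _ => ?_
  rw [cubeNoise, Finset.mul_sum]
  refine Finset.sum_congr rfl fun y _ => ?_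
  rw [restrictCube, cubeKernel_split S]
  simp only [Equiv.apply_symm_apply, restrictCube, mul_assoc]

lemma card_add_card_compl : Fintype.card S + Fintype.card {i // i ∉ S} = n := by
  rw [Fintype.card_subtype_compl, Fintype.card_coe, Fintype.card_fin]
  have := Finset.card_le_univ S
  rw [Fintype.card_fin] at this
  omega

lemma two_pow_mul_subcubeMass (f : Cube (Fin n) → ℝ) (b : Cube S) :
    2 ^ Fintype.card S * subcubeMass f S b =
      (∑ y, restrictCube S f b y) / 2 ^ Fintype.card {i // i ∉ S} := by
  classical
  have h : ∀ (a : Cube S) (y : Cube {i // i ∉ S}),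
      restrictCube S (fun x => if ∀ i : S, x i = b i then f x else 0) a y =
        if a = b then restrictCube S f b y else 0 := by
    intro a y
    have e : (∀ i : S, (cubeSplit S).symm (a, y) i = b i) ↔ a = b := by
      have e1 : ∀ i : S, (cubeSplit S).symm (a, y) i = a i := fun i =>
        congrFun (congrArg Prod.fst ((cubeSplit S).apply_symm_apply (a, y))) i
      simp only [e1, funext_iff]
    simp only [restrictCube, e]
    split_ifs with hab
    · rw [hab]
    · rfl
  have hn : (2 : ℝ) ^ n = 2 ^ Fintype.card S * 2 ^ Fintype.card {i // i ∉ S} := by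
    rw [← pow_add, card_add_card_compl]
  have hs : ∑ a, ∑ y, (if a = b then restrictCube S f b y else 0) =
      ∑ y, restrictCube S f b y := by
    rw [Finset.sum_comm]
    simp
  rw [subcubeMass, mean, sum_eq_sum_restrictCube S]
  simp only [h]
  rw [hs, hn]
  field_simp

lemma mean_noiseOp_le_Gamma {Φ : ℝ → ℝ} (hΦc : ContinuousOn Φ (Set.Icc 0 1))
    (hΦ : ConvexOn ℝ (Set.Icc 0 1) Φ) {ρ : ℝ} (hρ : ρ ∈ Set.Icc (0 : ℝ) 1)
    {f : Cube (Fin n) → ℝ} (hf : IsBoolean f) :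
    mean (fun x => Φ (noiseOp ρ f x)) ≤
      Gamma Φ ρ (fun a : Cube S => 2 ^ Fintype.card S * subcubeMass f S a) := by
  have hn : (2 : ℝ) ^ n = 2 ^ Fintype.card {i // i ∉ S} * 2 ^ Fintype.card S := by
    rw [← pow_add, add_comm, card_add_card_compl]
  have hcard : (Fintype.card (Cube {i // i ∉ S}) : ℝ) = 2 ^ Fintype.card {i // i ∉ S} := by
    simp
  have hfb : ∀ b x, restrictCube S f b x = 0 ∨ restrictCube S f b x = 1 := fun b x => hf _
  have hfI : ∀ b x, restrictCube S f b x ∈ Set.Icc (0 : ℝ) 1 := fun b x => by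
    rcases hfb b x with h | h <;> simp [h]
  simp only [Gamma, two_pow_mul_subcubeMass, hammingDist_weight_eq_cubeKernel]
  rw [mean, hn, ← div_div, sum_eq_sum_restrictCube S, Finset.sum_div]
  gcongr with a _
  -- The weighted sum over b is the noise operator on the cube of `S` applied to w.
  have conv : ∀ {w : Cube S → ℝ}, (∀ b, w b ∈ Set.Icc (0 : ℝ) 1) →
      ∑ b, cubeKernel ρ a b * w b ∈ Set.Icc (0 : ℝ) 1 := fun hw => cubeNoise_mem_Icc hρ hw a
  have hint := fun b => intervalIntegrable_of_mem_Icc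
    (measurable_theta ρ ((∑ y, restrictCube S f b y) / 2 ^ Fintype.card {i // i ∉ S}))
    (fun u => theta_mem_Icc hρ _ u)
  have hsum : ∀ r : ℝ, ∫ u in (0 : ℝ)..r, ∑ b, cubeKernel ρ a b *
      theta ρ ((∑ y, restrictCube S f b y) / 2 ^ Fintype.card {i // i ∉ S}) u =
      ∑ b, cubeKernel ρ a b * ∫ u in (0 : ℝ)..r,
        theta ρ ((∑ y, restrictCube S f b y) / 2 ^ Fintype.card {i // i ∉ S}) u := by
    intro r
    rw [intervalIntegral.integral_finsetSum fun b _ => (hint b _ _).const_mul _]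
    simp only [intervalIntegral.integral_const_mul]
  have key := sum_le_integral_of_convexOn hΦc hΦ
    (g := fun x => ∑ b, cubeKernel ρ a b * cubeNoise ρ (restrictCube S f b) x)
    (h := fun u => ∑ b, cubeKernel ρ a b *
      theta ρ ((∑ y, restrictCube S f b y) / 2 ^ Fintype.card {i // i ∉ S}) u)
    (fun x => conv fun b => cubeNoise_mem_Icc hρ (hfI b) x)
    (Finset.measurable_sum _ fun b _ => (measurable_theta _ _).const_mul _)
    (fun u => conv fun b => theta_mem_Icc hρ _ u) ?_ ?_
  · rw [hcard] at key
    refine le_trans (le_of_eq ?_) key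
    congr 1
    refine Finset.sum_congr rfl fun x _ => ?_
    rw [← restrictCube_noiseOp]
    rfl
  · intro B
    rw [hsum, Finset.sum_comm, Finset.mul_sum, hcard]
    refine Finset.sum_le_sum fun b _ => ?_
    rw [← Finset.mul_sum, mul_left_comm]
    exact mul_le_mul_of_nonneg_left (sum_cubeNoise_le_integral_theta hρ (hfb b) B)
      (cubeKernel_nonneg hρ _ _)
  · rw [hsum, Finset.sum_comm, Finset.mul_sum, hcard]
    refine Finset.sum_congr rfl fun b _ => ?_
    have h0 : 0 ≤ ∑ y, restrictCube S f b y := Finset.sum_nonneg fun y _ => (hfI b y).1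
    have h1 : ∑ y, restrictCube S f b y ≤ 2 ^ Fintype.card {i // i ∉ S} := by
      rw [← hcard, ← Finset.card_univ, Finset.cast_card]
      exact Finset.sum_le_sum fun y _ => (hfI b y).2
    rw [← Finset.mul_sum, sum_cubeNoise, integral_theta hρ ⟨by positivity,
      (div_le_one (by positivity)).2 h1⟩]
    field_simp

end

end NoiseStability

theorem mainTheorem10 (Φ : ℝ → ℝ) (hΦc : ContinuousOn Φ (Set.Icc 0 1))
    (hΦ : ConvexOn ℝ (Set.Icc 0 1) Φ) (ρ : ℝ) (hρ : ρ ∈ Set.Icc (0 : ℝ) 1)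
    (n k : ℕ) (hk : k ≤ n) (f : NoiseStability.Cube (Fin n) → ℝ)
    (hf : NoiseStability.IsBoolean f) :
    NoiseStability.mean (fun x => Φ (NoiseStability.noiseOp ρ f x)) ≤
      (Finset.powersetCard k (Finset.univ : Finset (Fin n))).inf'
        (Finset.powersetCard_nonempty.mpr (by simpa using hk))
        (fun S => NoiseStability.Gamma Φ ρ
          (fun a : NoiseStability.Cube S => 2 ^ k * NoiseStability.subcubeMass f S a)) := by
  refine Finset.le_inf' _ _ fun S hS => ?_
  have hcard : Fintype.card S = k := by
    rw [Fintype.card_coe]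
    exact (Finset.mem_powersetCard.1 hS).2
  rw [← hcard]
  exact NoiseStability.mean_noiseOp_le_Gamma S hΦc hΦ hρ hf
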